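/- Let $d\ge 2$, let $P$ be a probability distribution on a sample space $\mathcal X$, let $\Theta\subset\mathbb R^d$ be compact and convex, and let $f(\cdot;x)$, $x\in\mathcal X$, be real-valued losses, convex on $\Theta$, with $f(\theta;\cdot)$ $P$-integrable for every $\theta\in\Theta$. Put $F_0(\theta)=\mathbb E_P[f(\theta;X)]$, and suppose that $F_0$ has a unique minimizer $\theta^*$ over $\Theta$. Write $\|\cdot\|$ for the Euclidean norm of vectors and the $\ell_2$-operator norm of matrices. Assume: (1) $\theta^*\in\operatorname{int}\Theta$; put $R=\max_{\theta\in\Theta}\|\theta-\theta^*\|$. (2) $F_0$ is twice differentiable (on the interior of $\Theta$) and $\nabla^2F_0(\theta^*)\succeq\lambda I$ for some $\lambda>0$. (3) For some $\rho>0$, the ball $U=\{\theta:\|\theta-\theta^*\|<\rho\}$ is contained in $\Theta$; for every $x$, $f(\cdot;x)$ is twice differentiable on $U$; and there are finite constants $G,H,L\ge 0$ such that $\mathbb E\|\nabla f(\theta;X)\|^8\le G^8$ and $\mathbb E\|\nabla^2f(\theta;X)-\nabla^2F_0(\theta)\|^8\le H^8$ for all $\theta\in U$, and $\|\nabla^2f(\theta';x)-\nabla^2f(\theta;x)\|\le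 L(x)\|\theta'-\theta\|$ for all $\theta,\theta'\in U$ and all $x$, where $\mathbb E[L(X)^8]\le L^8$ and $\mathbb E[(L(X)-\mathbb E L(X))^8]\le L^8$. Let $m,n\ge 1$, let $S_1,\dots,S_m$ be independent data sets, each of $n$ i.i.d. samples from $P$, let $\theta_i\in\operatorname{argmin}_{\theta\in\Theta}\frac1n\sum_{x\in S_i}f(\theta;x)$ be a minimizer computed (measurably) from $S_i$, and let $\bar\theta=\frac1m\sum_{i=1}^m\theta_i$. Then $$\mathbb E\|\bar\theta-\theta^*\|^2\le\frac{2G^2}{\lambda^2nm}+\frac{cG^2}{\lambda^4n^2}\Big(H^2\log d+\frac{L^2G^2}{\lambda^2}\Big)+\frac{C_1}{mn^2}+\frac{C_2}{n^3},$$ where $c$ is a numerical constant, and $C_1,C_2$ depend only on $d,R,\lambda,\rho,G,H,L$ (not on $m$ and $n$). -/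

import Mathlib

open MeasureTheory
open scoped BigOperators

namespace AvgM

/-- The parameter space `ℝ^d` with its Euclidean norm. -/
abbrev Vec (d : ℕ) : Type := EuclideanSpace ℝ (Fin d)

variable {d : ℕ} {X : Type*}

/-- The Hessian of `F` at `θ`, as a linear operator on `ℝ^d` (the derivative of the gradient).
Its norm is the `ℓ₂`-operator norm. -/
noncomputable def hessian (F : Vec d → ℝ) (θ : Vec d) : Vec d →L[ℝ] Vec d :=
  fderiv ℝ (gradient F) θ

/-- The population risk `F₀(θ) = 𝔼_P[f(θ; X)]`. -/
noncomputable def populationRisk [MeasurableSpace X] (f : Vec d → X → ℝ) (P : Measure X)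
    (θ : Vec d) : ℝ :=
  ∫ x, f θ x ∂P

/-- The empirical risk of the data set `S = (S 0, …, S (n-1))`. -/
noncomputable def empiricalRisk {n : ℕ} (f : Vec d → X → ℝ) (S : Fin n → X) (θ : Vec d) : ℝ :=
  (1 / (n : ℝ)) * ∑ j, f θ (S j)

/-- The basic set-up: the losses are convex on `Θ` and integrable, and `θstar` is the unique
minimizer over `Θ` of the population risk. -/
structure RiskProblem [MeasurableSpace X] (f : Vec d → X → ℝ) (P : Measure X)
    (Θ : Set (Vec d)) (θstar : Vec d) : Prop where
  convex_loss : ∀ x, ConvexOn ℝ Θ (fun θ => f θ x)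
  integrable_loss : ∀ θ ∈ Θ, Integrable (f θ) P
  mem : θstar ∈ Θ
  unique_min : ∀ θ ∈ Θ, θ ≠ θstar → populationRisk f P θstar < populationRisk f P θ

/-- Parameter space: compact, convex, `θstar` interior, radius `R = max_{θ ∈ Θ} ‖θ - θstar‖`. -/
structure ParameterAssumption (Θ : Set (Vec d)) (θstar : Vec d) (R : ℝ) : Prop where
  isCompact : IsCompact Θ
  convex : Convex ℝ Θ
  mem_interior : θstar ∈ interior Θ
  radius : IsGreatest ((fun θ => ‖θ - θstar‖) '' Θ) R

/-- Local strong convexity: the population risk is twice differentiable and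
`∇²F₀(θstar) ⪰ lam • I` in the positive semidefinite order. -/
structure LocalStrongConvexity [MeasurableSpace X] (f : Vec d → X → ℝ) (P : Measure X)
    (Θ : Set (Vec d)) (θstar : Vec d) (lam : ℝ) : Prop where
  lam_pos : 0 < lam
  differentiable : DifferentiableOn ℝ (populationRisk f P) (interior Θ)
  differentiable_gradient : DifferentiableOn ℝ (gradient (populationRisk f P)) (interior Θ)
  curvature :
    (hessian (populationRisk f P) θstar - lam • ContinuousLinearMap.id ℝ (Vec d)).IsPositive

/-- Smoothness of the losses on the ball `U` of radius `ρ` about `θstar`, with eighth moment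
bounds `G` (gradient), `H` (Hessian) and `L` (Lipschitz constant of the Hessian). The open ball
is used, so that only values of the losses on `Θ` enter the derivatives. -/
structure SmoothnessAssumption [MeasurableSpace X] (f : Vec d → X → ℝ) (P : Measure X)
    (Θ : Set (Vec d)) (θstar : Vec d) (ρ G H L : ℝ) : Prop where
  rho_pos : 0 < ρ
  G_nonneg : 0 ≤ G
  H_nonneg : 0 ≤ H
  L_nonneg : 0 ≤ L
  ball_subset : Metric.ball θstar ρ ⊆ Θ
  differentiable : ∀ x, ∀ θ ∈ Metric.ball θstar ρ, DifferentiableAt ℝ (fun η => f η x) θ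
  differentiable_gradient : ∀ x, ∀ θ ∈ Metric.ball θstar ρ,
    DifferentiableAt ℝ (gradient (fun η => f η x)) θ
  gradient_memLp : ∀ θ ∈ Metric.ball θstar ρ,
    MemLp (fun x => gradient (fun η => f η x) θ) 8 P
  gradient_moment : ∀ θ ∈ Metric.ball θstar ρ,
    ∫ x, ‖gradient (fun η => f η x) θ‖ ^ 8 ∂P ≤ G ^ 8
  hessian_memLp : ∀ θ ∈ Metric.ball θstar ρ,
    MemLp (fun x => hessian (fun η => f η x) θ - hessian (populationRisk f P) θ) 8 P
  hessian_moment : ∀ θ ∈ Metric.ball θstar ρ,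
    ∫ x, ‖hessian (fun η => f η x) θ - hessian (populationRisk f P) θ‖ ^ 8 ∂P ≤ H ^ 8
  hessian_lipschitz : ∃ Lip : X → ℝ, MemLp Lip 8 P ∧
    (∀ x, ∀ θ ∈ Metric.ball θstar ρ, ∀ θ' ∈ Metric.ball θstar ρ,
      ‖hessian (fun η => f η x) θ' - hessian (fun η => f η x) θ‖ ≤ Lip x * ‖θ' - θ‖) ∧
    ∫ x, Lip x ^ 8 ∂P ≤ L ^ 8 ∧
    ∫ x, (Lip x - ∫ y, Lip y ∂P) ^ 8 ∂P ≤ L ^ 8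

/-- The law of a data set of `n` i.i.d. samples from `P`. -/
noncomputable def sampleLaw [MeasurableSpace X] (P : Measure X) (n : ℕ) : Measure (Fin n → X) :=
  Measure.pi fun _ => P

/-- The law of `m` independent data sets of `n` i.i.d. samples each. -/
noncomputable def dataLaw [MeasurableSpace X] (P : Measure X) (m n : ℕ) :
    Measure (Fin m → Fin n → X) :=
  Measure.pi fun _ => sampleLaw P n

/-- `T` computes from a data set of size `n` a minimizer over `Θ` of its empirical risk. -/
structure IsEmpiricalMinimizer [MeasurableSpace X] (f : Vec d → X → ℝ) (P : Measure X)
    (Θ : Set (Vec d)) {n : ℕ} (T : (Fin n → X) → Vec d) : Prop where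
  aemeasurable : AEMeasurable T (sampleLaw P n)
  mem : ∀ᵐ S ∂(sampleLaw P n), T S ∈ Θ
  isMinOn : ∀ᵐ S ∂(sampleLaw P n), IsMinOn (empiricalRisk f S) Θ (T S)

/-- The averaged estimate `(1/m) ∑ i, θ_i`, where machine `i` computes `θ_i = T i (S i)` from its
own data set `S i`. -/
noncomputable def average {m n : ℕ} (T : Fin m → (Fin n → X) → Vec d) (S : Fin m → Fin n → X) :
    Vec d :=
  (1 / (m : ℝ)) • ∑ i, T i (S i)

end AvgM

/-! For one data set let `D` be the error of its minimizer, `M₀` the Hessian of the population risk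
at `θstar` and `J` its inverse. Let `g`, `M₀ - B` and `l + ε` be the empirical averages of the
gradient at `θstar`, the Hessian at `θstar` and the Lipschitz constant, where `l` is the mean of the
last. Then `g`, `B`, `ε` are averages of `n` i.i.d. centred variables, so `q = ‖g‖ + ‖B‖ + |ε|`
satisfies `𝔼 q⁴ = O(n⁻²)`.

If the deviations are small, convexity forces the minimizer close to `θstar`; there its gradient
vanishes, and Taylor expansion gives `D = -Jg + JBD + Js` with `‖s‖ ≤ (l + ε)‖D‖²`
(`norm_minimizer_sub_le`). Inserting this relation into itself yields `D = -Jg + O(q²)`, and `D =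
-Jg - JBJg` up to `(L/λ)‖D‖² + O(q³)`. If they are not small, then `‖D‖ ≤ R` and `q` exceeds a fixed
threshold, so powers of `q` absorb `R`. Hence both expansions hold for almost every sample and no
tail estimate is needed (`exists_deviation_bounds`).

In expectation (`moment_bounds_of_deviation_bounds`), `Jg` vanishes, and in `JBJg` only the products
of terms from the same sample survive, contributing at most `HG/(λ²n)`. The mean square of `D` is
thus `2G²/(λ²n) + O(n⁻²)`, and its bias is at most `(HG/λ² + 2LG²/λ³)/n + O(n^(-3/2))`. Averaging
over `m` machines divides the mean square by `m` but leaves the bias (`integral_norm_avg_sq_le`);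
squaring the bias gives the `n⁻²` and `n⁻³` terms. The argument produces no logarithm: `log d`
enters only because it is bounded below for `d ≥ 2`. -/

namespace AvgM

open ProbabilityTheory

/-! ### Moments of sums of independent variables -/

section Moments

variable {Ω : Type*} [MeasurableSpace Ω] {μ : Measure Ω}
  {E F K : Type*} [NormedAddCommGroup E] [NormedSpace ℝ E] [NormedAddCommGroup F] [NormedSpace ℝ F]
  [NormedAddCommGroup K] [NormedSpace ℝ K]

lemma integrable_bilin_of_memLp_two (B : E →L[ℝ] F →L[ℝ] K) {Z : Ω → E} {W : Ω → F}
    (hZ : MemLp Z 2 μ) (hW : MemLp W 2 μ) : Integrable (fun x => B (Z x) (W x)) μ := by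
  have h : Integrable (fun x => ‖B‖ * (‖Z x‖ * ‖W x‖)) μ :=
    (hZ.norm.integrable_mul hW.norm).const_mul _
  refine h.mono (B.aestronglyMeasurable_comp₂ hZ.1 hW.1) (.of_forall fun x => ?_)
  rw [Real.norm_of_nonneg (by positivity)]
  simpa [mul_assoc] using B.le_opNorm₂ (Z x) (W x)

/-- Cauchy–Schwarz. It bounds the Hessian–gradient correlation by `HG` with no dimensional factor.
-/
lemma norm_integral_bilin_le (B : E →L[ℝ] F →L[ℝ] K) {Z : Ω → E} {W : Ω → F}
    (hZ : MemLp Z 2 μ) (hW : MemLp W 2 μ) {b a c : ℝ} (hB : ∀ z w, ‖B z w‖ ≤ b * (‖z‖ * ‖w‖))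
    (hb : 0 ≤ b) (ha : 0 ≤ a) (hc : 0 ≤ c)
    (hZa : ∫ x, ‖Z x‖ ^ 2 ∂μ ≤ a ^ 2) (hWc : ∫ x, ‖W x‖ ^ 2 ∂μ ≤ c ^ 2) :
    ‖∫ x, B (Z x) (W x) ∂μ‖ ≤ b * (a * c) := by
  have h2 : (ENNReal.ofReal 2) = 2 := by norm_num
  have hmul := integral_mul_le_Lp_mul_Lq_of_nonneg (μ := μ) Real.HolderConjugate.two_two
    (f := fun x => ‖Z x‖) (g := fun x => ‖W x‖) (.of_forall fun _ => norm_nonneg _)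
    (.of_forall fun _ => norm_nonneg _) (h2 ▸ hZ.norm) (h2 ▸ hW.norm)
  simp only [Real.rpow_two, ← Real.sqrt_eq_rpow] at hmul
  have h1 : ∫ x, ‖Z x‖ * ‖W x‖ ∂μ ≤ a * c := by
    refine hmul.trans (mul_le_mul ?_ ?_ (Real.sqrt_nonneg _) ha)
    · exact (Real.sqrt_le_sqrt hZa).trans_eq (Real.sqrt_sq ha)
    · exact (Real.sqrt_le_sqrt hWc).trans_eq (Real.sqrt_sq hc)
  calc _ ≤ ∫ x, b * (‖Z x‖ * ‖W x‖) ∂μ :=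
        norm_integral_le_of_norm_le ((hZ.norm.integrable_mul hW.norm).const_mul _)
          (.of_forall fun x => hB _ _)
    _ ≤ _ := by rw [integral_const_mul]; gcongr

lemma integral_sq_le_of_pow_eight [IsProbabilityMeasure μ] {u : Ω → ℝ} (hu : MemLp u 8 μ) {a : ℝ}
    (h : ∫ x, u x ^ 8 ∂μ ≤ a ^ 8) : ∫ x, u x ^ 2 ∂μ ≤ a ^ 2 := by
  have i8 : Integrable (fun x => u x ^ 8) μ := by
    refine (hu.integrable_norm_pow (p := 8) (by norm_num)).congr (.of_forall fun x => ?_)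
    simpa using (Even.pow_abs (by decide : Even 8) (u x))
  have i2 : Integrable (fun x => u x ^ 2) μ :=
    (hu.mono_exponent (by norm_num : (2 : ENNReal) ≤ 8)).integrable_sq
  have := (convexOn_pow (𝕜 := ℝ) 4).map_integral_le (μ := μ) (f := fun x => u x ^ 2)
    (by fun_prop) isClosed_Ici (.of_forall fun x => sq_nonneg (u x)) i2
    (i8.congr (.of_forall fun x => by simp [← pow_mul]))
  simp only [← pow_mul] at this
  have h4 : (∫ x, u x ^ 2 ∂μ) ^ 4 ≤ (a ^ 2) ^ 4 := by
    rw [← pow_mul]; exact this.trans h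
  exact le_of_pow_le_pow_left₀ (by norm_num) (by positivity) h4

lemma integral_pow_four_le_of_pow_eight [IsProbabilityMeasure μ] {u : Ω → ℝ} (hu : MemLp u 8 μ)
    {a : ℝ} (h : ∫ x, u x ^ 8 ∂μ ≤ a ^ 8) : ∫ x, u x ^ 4 ∂μ ≤ a ^ 4 := by
  have i8 : Integrable (fun x => u x ^ 8) μ := by
    refine (hu.integrable_norm_pow (p := 8) (by norm_num)).congr (.of_forall fun x => ?_)
    simpa using (Even.pow_abs (by decide : Even 8) (u x))
  have i4 : Integrable (fun x => u x ^ 4) μ := by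
    refine ((hu.mono_exponent (by norm_num : (4 : ENNReal) ≤ 8)).integrable_norm_pow (p := 4)
      (by norm_num)).congr (.of_forall fun x => ?_)
    simpa using (Even.pow_abs (by decide : Even 4) (u x))
  have := (convexOn_pow (𝕜 := ℝ) 2).map_integral_le (μ := μ) (f := fun x => u x ^ 4)
    (by fun_prop) isClosed_Ici (.of_forall fun x => by simp; positivity) i4
    (i8.congr (.of_forall fun x => by simp [← pow_mul]))
  simp only [← pow_mul] at this
  have h4 : (∫ x, u x ^ 4 ∂μ) ^ 2 ≤ (a ^ 4) ^ 2 := by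
    rw [← pow_mul]; exact this.trans h
  exact le_of_pow_le_pow_left₀ (by norm_num) (by positivity) h4

lemma memLp_eval {E : Type*} [NormedAddCommGroup E] [IsProbabilityMeasure μ] {ι : Type*} [Fintype ι] {Z : Ω → E} {p : ENNReal}
    (hZ : MemLp Z p μ) (i : ι) :
    MemLp (fun S : ι → Ω => Z (S i)) p (Measure.pi fun _ => μ) :=
  hZ.comp_measurePreserving (measurePreserving_eval (fun _ => μ) i)

lemma integral_eval [IsProbabilityMeasure μ] {ι : Type*} [Fintype ι] {Z : Ω → E}
    (hZ : AEStronglyMeasurable Z μ) (i : ι) :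
    ∫ S : ι → Ω, Z (S i) ∂(Measure.pi fun _ => μ) = ∫ x, Z x ∂μ := by
  have h := (measurePreserving_eval (fun _ : ι => μ) i)
  conv_rhs => rw [← h.map_eq]
  rw [integral_map h.measurable.aemeasurable (by rwa [h.map_eq])]

lemma integral_bilin_eval_of_ne [CompleteSpace E] [CompleteSpace F] [CompleteSpace K]
    [IsProbabilityMeasure μ] {ι : Type*} [Fintype ι]
    (B : E →L[ℝ] F →L[ℝ] K) {Z : Ω → E} {W : Ω → F} (hZ : Integrable Z μ) (hW : Integrable W μ)
    {i j : ι} (hij : i ≠ j) :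
    ∫ S : ι → Ω, B (Z (S i)) (W (S j)) ∂(Measure.pi fun _ => μ)
      = B (∫ x, Z x ∂μ) (∫ x, W x ∂μ) := by
  have hind : iIndepFun (fun (i : ι) (S : ι → Ω) => S i) (Measure.pi fun _ => μ) :=
    iIndepFun_pi (X := fun _ : ι => (id : Ω → Ω)) fun _ => aemeasurable_id
  have hi := measurePreserving_eval (fun _ : ι => μ) i
  have hj := measurePreserving_eval (fun _ : ι => μ) j
  have := (hind.indepFun hij).integral_bilin_comp_comp (f := Z) (g := W)
    hi.measurable.aemeasurable hj.measurable.aemeasurable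
    (by simpa only [hi.map_eq] using (show Integrable Z ((Measure.pi fun _ : ι => μ).map
      (Function.eval i)) by rwa [hi.map_eq]))
    (by simpa only [hj.map_eq] using (show Integrable W ((Measure.pi fun _ : ι => μ).map
      (Function.eval j)) by rwa [hj.map_eq])) B
  rw [this, integral_eval hZ.1, integral_eval hW.1]

/-- The second (bilinear) moment of sums of i.i.d. mean-zero vectors. -/
lemma integral_bilin_sum [CompleteSpace E] [CompleteSpace F] [CompleteSpace K]
    [IsProbabilityMeasure μ] {ι : Type*} [Fintype ι] [DecidableEq ι]
    (B : E →L[ℝ] F →L[ℝ] K) {Z : Ω → E} {W : Ω → F} (hZ : MemLp Z 2 μ) (hW : MemLp W 2 μ)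
    (hZ0 : ∫ x, Z x ∂μ = 0) :
    ∫ S : ι → Ω, B (∑ i, Z (S i)) (∑ j, W (S j)) ∂(Measure.pi fun _ => μ)
      = (Fintype.card ι : ℝ) • ∫ x, B (Z x) (W x) ∂μ := by
  have hint (i j : ι) : Integrable (fun S : ι → Ω => B (Z (S i)) (W (S j)))
      (Measure.pi fun _ => μ) :=
    integrable_bilin_of_memLp_two B (memLp_eval hZ i) (memLp_eval hW j)
  simp only [map_sum, sum_apply]
  rw [integral_finsetSum _ fun i _ => integrable_finsetSum _ fun j _ => hint _ _]
  simp_rw [integral_finsetSum _ fun j _ => hint _ _]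
  -- Off the diagonal independence factors the integral, so it suffices that one of the two
  -- variables is centred.
  have h (i j : ι) : ∫ S : ι → Ω, B (Z (S i)) (W (S j)) ∂(Measure.pi fun _ => μ)
      = if i = j then ∫ x, B (Z x) (W x) ∂μ else 0 := by
    split_ifs with hij
    · subst hij
      exact integral_eval (Z := fun x => B (Z x) (W x))
        (integrable_bilin_of_memLp_two B hZ hW).1 i
    · rw [integral_bilin_eval_of_ne B (hZ.integrable (by norm_num)) (hW.integrable (by norm_num))
        hij, hZ0]
      simp
  simp [h, Nat.cast_smul_eq_nsmul]

/-- Induction on the index set. A new summand is independent of the partial sum and both are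
centred, so every term of the binomial expansion with a first power integrates to zero. The
fourth-moment step needs the second moment of the partial sum, so the two bounds are proved
together. -/
lemma integral_sum_pow_le_of_iIndepFun [IsProbabilityMeasure μ] {ι : Type*} {Y : ι → Ω → ℝ}
    (hY : iIndepFun Y μ) (h4 : ∀ i, MemLp (Y i) 4 μ) (h0 : ∀ i, ∫ x, Y i x ∂μ = 0) {v M : ℝ}
    (hv : 0 ≤ v) (hvM : v ^ 2 ≤ M) (h2v : ∀ i, ∫ x, Y i x ^ 2 ∂μ ≤ v)
    (h4M : ∀ i, ∫ x, Y i x ^ 4 ∂μ ≤ M) (s : Finset ι) :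
    ∫ x, (∑ i ∈ s, Y i x) ^ 2 ∂μ ≤ s.card * v ∧
    ∫ x, (∑ i ∈ s, Y i x) ^ 4 ∂μ ≤ 3 * (s.card : ℝ) ^ 2 * M := by
  classical
  have ipow {u : Ω → ℝ} (hu : MemLp u 4 μ) (k : ℕ) (hk : k ≤ 4) :
      Integrable (fun x => u x ^ k) μ := by
    have h := (hu.mono_exponent (by exact_mod_cast hk : (k : ENNReal) ≤ 4)).integrable_norm_pow'
    refine (integrable_norm_iff (hu.1.pow k)).1 (h.congr (.of_forall fun x => ?_))
    simp
  induction s using Finset.induction_on with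
  | empty => simp
  | insert a s ha ih =>
    obtain ⟨ih2, ih4⟩ := ih
    have hS4 : MemLp (fun x => ∑ i ∈ s, Y i x) 4 μ := memLp_finsetSum s fun i _ => h4 i
    have hSa : IndepFun (fun x => ∑ i ∈ s, Y i x) (Y a) μ := by
      have := hY.indepFun_finsetSum_of_notMem₀ (fun i => (h4 i).1.aemeasurable) ha
      convert this using 1
      ext x; simp
    set S : Ω → ℝ := fun x => ∑ i ∈ s, Y i x with hS
    have hS0 : ∫ x, S x ∂μ = 0 := by
      rw [hS, integral_finsetSum _ fun i _ => (h4 i).integrable (by norm_num)]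
      simp [h0]
    have hprod (k l : ℕ) : ∫ x, S x ^ k * Y a x ^ l ∂μ
        = (∫ x, S x ^ k ∂μ) * ∫ x, Y a x ^ l ∂μ :=
      hSa.integral_fun_comp_mul_comp (f := fun t => t ^ k) (g := fun t => t ^ l)
        hS4.1.aemeasurable (h4 a).1.aemeasurable (by fun_prop) (by fun_prop)
    have hpint (k l : ℕ) (hk : k ≤ 4) (hl : l ≤ 4) :
        Integrable (fun x => S x ^ k * Y a x ^ l) μ :=
      (hSa.comp (measurable_id.pow_const k) (measurable_id.pow_const l)).integrable_mul
        (ipow hS4 k hk) (ipow (h4 a) l hl)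
    have e2 : ∫ x, (S x + Y a x) ^ 2 ∂μ = ∫ x, S x ^ 2 ∂μ + ∫ x, Y a x ^ 2 ∂μ := by
      have : ∀ x, (S x + Y a x) ^ 2 = S x ^ 2 + (2 * (S x ^ 1 * Y a x ^ 1) + Y a x ^ 2) :=
        fun x => by ring
      simp_rw [this]
      have i1 := (hpint 1 1 (by norm_num) (by norm_num)).const_mul 2
      have i2 := ipow (h4 a) 2 (by norm_num)
      have i12 : Integrable (fun x => 2 * (S x ^ 1 * Y a x ^ 1) + Y a x ^ 2) μ := i1.add i2
      rw [integral_add (ipow hS4 2 (by norm_num)) i12, integral_add i1 i2, integral_const_mul,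
        hprod]
      simp [hS0]
    have e4 : ∫ x, (S x + Y a x) ^ 4 ∂μ = ∫ x, S x ^ 4 ∂μ
        + 6 * ((∫ x, S x ^ 2 ∂μ) * ∫ x, Y a x ^ 2 ∂μ) + ∫ x, Y a x ^ 4 ∂μ := by
      have : ∀ x, (S x + Y a x) ^ 4 = S x ^ 4 + (4 * (S x ^ 3 * Y a x ^ 1) +
          (6 * (S x ^ 2 * Y a x ^ 2) + (4 * (S x ^ 1 * Y a x ^ 3) + Y a x ^ 4))) :=
        fun x => by ring
      simp_rw [this]
      have i1 := (hpint 3 1 (by norm_num) (by norm_num)).const_mul 4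
      have i2 := (hpint 2 2 (by norm_num) (by norm_num)).const_mul 6
      have i3 := (hpint 1 3 (by norm_num) (by norm_num)).const_mul 4
      have i4 := ipow (h4 a) 4 le_rfl
      have i34 : Integrable (fun x => 4 * (S x ^ 1 * Y a x ^ 3) + Y a x ^ 4) μ := i3.add i4
      have i24 : Integrable (fun x => 6 * (S x ^ 2 * Y a x ^ 2) +
          (4 * (S x ^ 1 * Y a x ^ 3) + Y a x ^ 4)) μ := i2.add i34
      have i14 : Integrable (fun x => 4 * (S x ^ 3 * Y a x ^ 1) + (6 * (S x ^ 2 * Y a x ^ 2) +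
          (4 * (S x ^ 1 * Y a x ^ 3) + Y a x ^ 4))) μ := i1.add i24
      rw [integral_add (ipow hS4 4 le_rfl) i14, integral_add i1 i24, integral_add i2 i34,
        integral_add i3 i4]
      simp only [integral_const_mul, hprod]
      simp [hS0, h0]
      ring
    simp only [Finset.sum_insert ha, Finset.card_insert_of_notMem ha]
    have comm : ∀ x, Y a x + ∑ i ∈ s, Y i x = S x + Y a x := fun x => add_comm _ _
    simp only [comm, e2, e4]
    push_cast
    have hY2 : 0 ≤ ∫ x, Y a x ^ 2 ∂μ := integral_nonneg fun x => sq_nonneg _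
    have hmix : (∫ x, S x ^ 2 ∂μ) * ∫ x, Y a x ^ 2 ∂μ ≤ (s.card * v) * v :=
      mul_le_mul ih2 (h2v a) hY2 (by positivity)
    have hM : 0 ≤ M := (sq_nonneg v).trans hvM
    constructor
    · linarith [h2v a]
    -- With `k = s.card`, this is `3k²M + 6kv² + M ≤ 3(k + 1)²M`, by `v² ≤ M`.
    · have hc : (0 : ℝ) ≤ s.card := by positivity
      have := mul_le_mul_of_nonneg_left hvM hc
      nlinarith [h4M a]

lemma integral_sum_eval_pow_four_le [IsProbabilityMeasure μ] {ι : Type*} [Fintype ι] {u : Ω → ℝ}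
    (hu : MemLp u 4 μ) (h0 : ∫ x, u x ∂μ = 0) :
    ∫ S : ι → Ω, (∑ i, u (S i)) ^ 4 ∂(Measure.pi fun _ => μ)
      ≤ 3 * (Fintype.card ι : ℝ) ^ 2 * ∫ x, u x ^ 4 ∂μ := by
  have hu2 : MemLp u 2 μ := hu.mono_exponent (by norm_num)
  have i4 : Integrable (fun x => u x ^ 4) μ := by
    refine (hu.integrable_norm_pow (p := 4) (by norm_num)).congr (.of_forall fun x => ?_)
    simpa using (Even.pow_abs (by decide : Even 4) (u x))
  have jensen := (convexOn_pow (𝕜 := ℝ) 2).map_integral_le (μ := μ) (f := fun x => u x ^ 2)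
    (by fun_prop) isClosed_Ici (.of_forall fun x => sq_nonneg (u x)) hu2.integrable_sq
    (i4.congr (.of_forall fun x => by simp [← pow_mul]))
  simp only [← pow_mul] at jensen
  refine (integral_sum_pow_le_of_iIndepFun (Y := fun (i : ι) (S : ι → Ω) => u (S i))
    (iIndepFun_pi (X := fun _ : ι => u) fun _ => hu.1.aemeasurable) (fun i => memLp_eval hu i)
    (fun i => (integral_eval hu.1 i).trans h0) (v := ∫ x, u x ^ 2 ∂μ) (M := ∫ x, u x ^ 4 ∂μ)
    (integral_nonneg fun x => sq_nonneg _) jensen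
    (fun i => (integral_eval (Z := fun x => u x ^ 2) (hu.1.pow 2) i).le)
    (fun i => (integral_eval (Z := fun x => u x ^ 4) (hu.1.pow 4) i).le) Finset.univ).2

end Moments

/-- The fourth moment of an average of i.i.d. mean-zero vectors in a finite-dimensional space is
`O(n⁻²)`, with a constant that depends only on the space. -/
lemma exists_integral_norm_avg_pow_four_le (E : Type*) [NormedAddCommGroup E] [NormedSpace ℝ E]
    [FiniteDimensional ℝ E] :
    ∃ K : ℝ, 0 ≤ K ∧ ∀ (Ω : Type*) [MeasurableSpace Ω] (μ : Measure Ω) [IsProbabilityMeasure μ]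
      (Z : Ω → E), MemLp Z 4 μ → ∫ x, Z x ∂μ = 0 → ∀ n : ℕ, 1 ≤ n →
      ∫ S : Fin n → Ω, ‖(1 / (n : ℝ)) • ∑ j, Z (S j)‖ ^ 4 ∂(Measure.pi fun _ => μ)
        ≤ K * (∫ x, ‖Z x‖ ^ 4 ∂μ) / n ^ 2 := by
  let b := Module.finBasis ℝ E
  let N := Module.finrank ℝ E
  let φ : Fin N → (E →L[ℝ] ℝ) := fun i => LinearMap.toContinuousLinearMap (b.coord i)
  have hφ (i) (z : E) : φ i z = b.repr z i := rfl
  -- Coordinates in a basis reduce the claim to the scalar case; `N ^ 3` comes from using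
  -- Cauchy–Schwarz twice.
  have hrepr (z : E) : ‖z‖ ^ 4 ≤ (N : ℝ) ^ 3 * ∑ i, ‖b i‖ ^ 4 * φ i z ^ 4 := by
    have h1 : ‖z‖ ≤ ∑ i, |φ i z| * ‖b i‖ := by
      conv_lhs => rw [← b.sum_repr z]
      refine (norm_sum_le _ _).trans_eq (Finset.sum_congr rfl fun i _ => ?_)
      rw [norm_smul, Real.norm_eq_abs, hφ]
    calc ‖z‖ ^ 4 ≤ (∑ i, |φ i z| * ‖b i‖) ^ 4 := by gcongr
      _ ≤ (N : ℝ) ^ 3 * ∑ i, (|φ i z| * ‖b i‖) ^ 4 := by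
          have h2 := sq_sum_le_card_mul_sum_sq (s := Finset.univ) (f := fun i => |φ i z| * ‖b i‖)
          have h4 := sq_sum_le_card_mul_sum_sq (s := Finset.univ)
            (f := fun i => (|φ i z| * ‖b i‖) ^ 2)
          simp only [Finset.card_univ, Fintype.card_fin, ← pow_mul] at h2 h4
          calc (∑ i, |φ i z| * ‖b i‖) ^ 4 = ((∑ i, |φ i z| * ‖b i‖) ^ 2) ^ 2 := by ring
            _ ≤ (N * ∑ i, (|φ i z| * ‖b i‖) ^ 2) ^ 2 := by gcongr
            _ = (N : ℝ) ^ 2 * (∑ i, (|φ i z| * ‖b i‖) ^ 2) ^ 2 := by ring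
            _ ≤ (N : ℝ) ^ 2 * (N * ∑ i, (|φ i z| * ‖b i‖) ^ (2 * 2)) := by gcongr
            _ = _ := by ring
      _ = _ := by
          congr 1
          refine Finset.sum_congr rfl fun i _ => ?_
          rw [mul_pow, Even.pow_abs (by decide : Even 4), mul_comm]
  refine ⟨3 * N ^ 3 * ∑ i, ‖b i‖ ^ 4 * ‖φ i‖ ^ 4, by positivity, ?_⟩
  intro Ω _ μ _ Z hZ hZ0 n hn
  have hn0 : (n : ℝ) ≠ 0 := by positivity
  have hφZ (i) : MemLp (fun x => φ i (Z x)) 4 μ := (φ i).comp_memLp' hZ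
  have hφ0 (i) : ∫ x, φ i (Z x) ∂μ = 0 := by
    rw [(φ i).integral_comp_comm (hZ.integrable (by norm_num)), hZ0, map_zero]
  have hsum (i) : MemLp (fun S : Fin n → Ω => ∑ j, φ i (Z (S j))) 4 (Measure.pi fun _ => μ) :=
    memLp_finsetSum _ fun j _ => memLp_eval (hφZ i) j
  have hsint (i) : Integrable (fun S : Fin n → Ω => (∑ j, φ i (Z (S j))) ^ 4)
      (Measure.pi fun _ => μ) := by
    refine ((hsum i).integrable_norm_pow (p := 4) (by norm_num)).congr (.of_forall fun x => ?_)
    simpa using (Even.pow_abs (by decide : Even 4) _)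
  have hmom (i) : ∫ x, φ i (Z x) ^ 4 ∂μ ≤ ‖φ i‖ ^ 4 * ∫ x, ‖Z x‖ ^ 4 ∂μ := by
    rw [← integral_const_mul]
    refine integral_mono_of_nonneg (.of_forall fun x => by simp; positivity)
      ((hZ.integrable_norm_pow (p := 4) (by norm_num)).const_mul _) (.of_forall fun x => ?_)
    simp only
    rw [← mul_pow, ← Even.pow_abs (by decide : Even 4)]
    gcongr
    exact (φ i).le_opNorm _
  calc ∫ S : Fin n → Ω, ‖(1 / (n : ℝ)) • ∑ j, Z (S j)‖ ^ 4 ∂(Measure.pi fun _ => μ)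
      ≤ ∫ S : Fin n → Ω, (1 / (n : ℝ)) ^ 4 * ((N : ℝ) ^ 3 *
          ∑ i, ‖b i‖ ^ 4 * (∑ j, φ i (Z (S j))) ^ 4) ∂(Measure.pi fun _ => μ) := by
        refine integral_mono_of_nonneg (.of_forall fun x => by simp)
          (((integrable_finsetSum _ fun i _ => (hsint i).const_mul _).const_mul _).const_mul _)
          (.of_forall fun S => ?_)
        simp only
        rw [norm_smul, mul_pow, Real.norm_of_nonneg (by positivity)]
        gcongr
        simpa only [map_sum] using hrepr (∑ j, Z (S j))
    _ = (1 / (n : ℝ)) ^ 4 * ((N : ℝ) ^ 3 * ∑ i, ‖b i‖ ^ 4 *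
          ∫ S : Fin n → Ω, (∑ j, φ i (Z (S j))) ^ 4 ∂(Measure.pi fun _ => μ)) := by
        rw [integral_const_mul, integral_const_mul,
          integral_finsetSum _ fun i _ => (hsint i).const_mul _]
        simp_rw [integral_const_mul]
        rfl
    _ ≤ (1 / (n : ℝ)) ^ 4 * ((N : ℝ) ^ 3 * ∑ i, ‖b i‖ ^ 4 *
          (3 * (n : ℝ) ^ 2 * (‖φ i‖ ^ 4 * ∫ x, ‖Z x‖ ^ 4 ∂μ))) := by
        gcongr with i _
        refine (integral_sum_eval_pow_four_le (hφZ i) (hφ0 i)).trans ?_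
        rw [Fintype.card_fin]
        gcongr
        exact hmom i
    _ = _ := by
        simp only [Finset.mul_sum, Finset.sum_mul, Finset.sum_div]
        refine Finset.sum_congr rfl fun i _ => ?_
        field_simp

/-! ### Taylor expansion of gradients and differentiation under the integral -/

open Metric

/-- Mean value inequality on the closed ball through `θ`, where the Hessian varies by at most `l *
‖θ - θ₀‖`. The sharper factor `1/2` is not needed. -/
lemma norm_gradient_sub_sub_le {d : ℕ} {φ : Vec d → ℝ} {θ₀ : Vec d} {ρ l : ℝ}
    (hdiff : ∀ θ ∈ ball θ₀ ρ, DifferentiableAt ℝ (gradient φ) θ) (hl : 0 ≤ l)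
    (hlip : ∀ θ ∈ ball θ₀ ρ, ‖hessian φ θ - hessian φ θ₀‖ ≤ l * ‖θ - θ₀‖)
    {θ : Vec d} (hθ : θ ∈ ball θ₀ ρ) :
    ‖gradient φ θ - gradient φ θ₀ - hessian φ θ₀ (θ - θ₀)‖ ≤ l * ‖θ - θ₀‖ ^ 2 := by
  have hsub : closedBall θ₀ ‖θ - θ₀‖ ⊆ ball θ₀ ρ :=
    closedBall_subset_ball (mem_ball_iff_norm.1 hθ)
  have := (convex_closedBall θ₀ ‖θ - θ₀‖).norm_image_sub_le_of_norm_fderiv_le' (𝕜 := ℝ)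
    (f := gradient φ) (φ := hessian φ θ₀) (C := l * ‖θ - θ₀‖)
    (fun η hη => hdiff η (hsub hη))
    (fun η hη => (hlip η (hsub hη)).trans
      (mul_le_mul_of_nonneg_left (mem_closedBall_iff_norm.1 hη) hl))
    (mem_closedBall_self (norm_nonneg _)) (y := θ) (mem_closedBall_iff_norm.2 le_rfl)
  linarith

lemma norm_gradient {d : ℕ} (φ : Vec d → ℝ) (θ : Vec d) : ‖gradient φ θ‖ = ‖fderiv ℝ φ θ‖ := by
  simp [gradient]

/-- Differentiation under the integral sign, for integrands with an integrable bound on the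
derivative in a ball. -/
lemma hasFDerivAt_integral_of_norm_fderiv_le {d : ℕ} {X E : Type*} [MeasurableSpace X]
    {P : Measure X} [NormedAddCommGroup E] [NormedSpace ℝ E] {F : Vec d → X → E} {c : Vec d}
    {ρ : ℝ} (hint : ∀ θ ∈ ball c ρ, Integrable (F θ) P)
    (hdiff : ∀ x, ∀ θ ∈ ball c ρ, DifferentiableAt ℝ (fun η => F η x) θ) {B : X → ℝ}
    (hB : Integrable B P) (hle : ∀ x, ∀ θ ∈ ball c ρ, ‖fderiv ℝ (fun η => F η x) θ‖ ≤ B x)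
    {θ₀ : Vec d} (hθ₀ : θ₀ ∈ ball c ρ)
    (hmeas : AEStronglyMeasurable (fun x => fderiv ℝ (fun η => F η x) θ₀) P) :
    HasFDerivAt (fun θ => ∫ x, F θ x ∂P) (∫ x, fderiv ℝ (fun η => F η x) θ₀ ∂P) θ₀ := by
  refine (hasFDerivAt_integral_of_dominated_loc_of_lip (s := ball c ρ)
    (bound := B) (isOpen_ball.mem_nhds hθ₀) ?_ (hint θ₀ hθ₀) hmeas (.of_forall fun x => ?_) hB
    (.of_forall fun x => (hdiff x θ₀ hθ₀).hasFDerivAt)).2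
  · filter_upwards [isOpen_ball.mem_nhds hθ₀] with θ hθ using (hint θ hθ).1
  · refine (convex_ball c ρ).lipschitzOnWith_of_nnnorm_fderiv_le (𝕜 := ℝ)
      (fun θ hθ => hdiff x θ hθ) fun θ hθ => ?_
    rw [← NNReal.coe_le_coe]
    simpa using (hle x θ hθ).trans (le_abs_self _)

lemma memLp_of_sub_const {X E : Type*} [MeasurableSpace X] {P : Measure X} [IsFiniteMeasure P]
    [NormedAddCommGroup E] {Z : X → E} {c : E} {p : ENNReal} (h : MemLp (fun x => Z x - c) p P) :
    MemLp Z p P :=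
  (h.add (memLp_const c)).ae_eq (.of_forall fun _ => sub_add_cancel _ _)

section Population

variable {d : ℕ} {X : Type*} [MeasurableSpace X] {P : Measure X} [IsProbabilityMeasure P]
  {f : Vec d → X → ℝ} {Θ : Set (Vec d)} {θstar : Vec d} {ρ G H L : ℝ}

lemma SmoothnessAssumption.hessian_loss_memLp
    (hS : SmoothnessAssumption f P Θ θstar ρ G H L) {θ : Vec d} (hθ : θ ∈ ball θstar ρ) :
    MemLp (fun x => hessian (fun η => f η x) θ) 8 P := by
  exact memLp_of_sub_const (hS.hessian_memLp θ hθ)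

/-- Dominating functions uniform over the ball, for differentiating under the integral. The moment
assumptions hold only point by point in `θ`; the Lipschitz bound carries the values at `θstar` to
the whole ball. -/
lemma SmoothnessAssumption.exists_bounds (hS : SmoothnessAssumption f P Θ θstar ρ G H L) :
    ∃ B₁ B₂ : X → ℝ, Integrable B₁ P ∧ Integrable B₂ P ∧ ∀ x, ∀ θ ∈ ball θstar ρ,
      ‖gradient (fun η => f η x) θ‖ ≤ B₁ x ∧ ‖hessian (fun η => f η x) θ‖ ≤ B₂ x := by
  obtain ⟨Lip, hLip, hle, -, -⟩ := hS.hessian_lipschitz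
  have hmem : θstar ∈ ball θstar ρ := mem_ball_self hS.rho_pos
  have i2 : Integrable (fun x => ‖hessian (fun η => f η x) θstar‖ + |Lip x| * ρ) P :=
    ((hS.hessian_loss_memLp hmem).integrable (by norm_num)).norm.add
      ((hLip.integrable (by norm_num)).abs.mul_const ρ)
  have h2 (x) (θ) (hθ : θ ∈ ball θstar ρ) : ‖hessian (fun η => f η x) θ‖
      ≤ ‖hessian (fun η => f η x) θstar‖ + |Lip x| * ρ := by
    have h1 := hle x θstar hmem θ hθ
    have h3 : ‖θ - θstar‖ < ρ := mem_ball_iff_norm.1 hθ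
    have h4 : Lip x * ‖θ - θstar‖ ≤ |Lip x| * ρ :=
      mul_le_mul (le_abs_self _) h3.le (norm_nonneg _) (abs_nonneg _)
    linarith [norm_le_norm_add_norm_sub' (hessian (fun η => f η x) θ)
      (hessian (fun η => f η x) θstar)]
  refine ⟨fun x => ‖gradient (fun η => f η x) θstar‖
    + (‖hessian (fun η => f η x) θstar‖ + |Lip x| * ρ) * ρ, _,
    ((hS.gradient_memLp θstar hmem).integrable (by norm_num)).norm.add (i2.mul_const ρ), i2,
    fun x θ hθ => ⟨?_, h2 x θ hθ⟩⟩
  have h1 := (convex_ball θstar ρ).norm_image_sub_le_of_norm_fderiv_le (𝕜 := ℝ)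
    (f := gradient (fun η => f η x)) (fun η hη => hS.differentiable_gradient x η hη)
    (fun η hη => h2 x η hη) hmem hθ
  have h3 : ‖θ - θstar‖ < ρ := mem_ball_iff_norm.1 hθ
  have h4 : (‖hessian (fun η => f η x) θstar‖ + |Lip x| * ρ) * ‖θ - θstar‖
      ≤ (‖hessian (fun η => f η x) θstar‖ + |Lip x| * ρ) * ρ :=
    mul_le_mul_of_nonneg_left h3.le (by have := hS.rho_pos; positivity)
  linarith [norm_le_norm_add_norm_sub' (gradient (fun η => f η x) θ)
      (gradient (fun η => f η x) θstar)]

lemma gradient_populationRisk (hR : RiskProblem f P Θ θstar)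
    (hS : SmoothnessAssumption f P Θ θstar ρ G H L) {θ : Vec d} (hθ : θ ∈ ball θstar ρ) :
    gradient (populationRisk f P) θ = ∫ x, gradient (fun η => f η x) θ ∂P := by
  obtain ⟨B₁, _, hB₁, _, hle⟩ := hS.exists_bounds
  have hfd (x) : fderiv ℝ (fun η => f η x) θ
      = InnerProductSpace.toDual ℝ (Vec d) (gradient (fun η => f η x) θ) := by
    simp [gradient]
  have hmeas : AEStronglyMeasurable (fun x => fderiv ℝ (fun η => f η x) θ) P := by
    simp only [hfd]
    exact (InnerProductSpace.toDual ℝ (Vec d)).continuous.comp_aestronglyMeasurable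
      (hS.gradient_memLp θ hθ).1
  have h := hasFDerivAt_integral_of_norm_fderiv_le
    (fun η hη => hR.integrable_loss η (hS.ball_subset hη)) hS.differentiable hB₁
    (fun x η hη => by simpa only [norm_gradient] using (hle x η hη).1) hθ hmeas
  have h' : fderiv ℝ (populationRisk f P) θ = ∫ x, fderiv ℝ (fun η => f η x) θ ∂P := h.fderiv
  have hint : ∫ x, gradient (fun η => f η x) θ ∂P
      = (InnerProductSpace.toDual ℝ (Vec d)).symm (∫ x, fderiv ℝ (fun η => f η x) θ ∂P) :=
    ((InnerProductSpace.toDual ℝ (Vec d)).symm.toContinuousLinearEquiv.integral_comp_comm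
      (fun x => fderiv ℝ (fun η => f η x) θ))
  rw [hint, ← h', gradient]

lemma hessian_populationRisk (hR : RiskProblem f P Θ θstar)
    (hS : SmoothnessAssumption f P Θ θstar ρ G H L) {θ : Vec d} (hθ : θ ∈ ball θstar ρ) :
    hessian (populationRisk f P) θ = ∫ x, hessian (fun η => f η x) θ ∂P := by
  obtain ⟨_, B₂, _, hB₂, hle⟩ := hS.exists_bounds
  have h := hasFDerivAt_integral_of_norm_fderiv_le
    (F := fun η x => gradient (fun η => f η x) η)
    (fun η hη => (hS.gradient_memLp η hη).integrable (by norm_num))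
    hS.differentiable_gradient hB₂ (fun x η hη => (hle x η hη).2) hθ
    (hS.hessian_loss_memLp hθ).1
  refine (h.congr_of_eventuallyEq ?_).fderiv
  filter_upwards [isOpen_ball.mem_nhds hθ] with η hη using gradient_populationRisk hR hS hη

end Population

lemma gradient_populationRisk_eq_zero {d : ℕ} {X : Type*} [MeasurableSpace X] {P : Measure X}
    {f : Vec d → X → ℝ} {Θ : Set (Vec d)} {θstar : Vec d} {ρ G H L : ℝ} (hR : RiskProblem f P Θ θstar)
    (hS : SmoothnessAssumption f P Θ θstar ρ G H L) :
    gradient (populationRisk f P) θstar = 0 := by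
  have hmin : IsLocalMin (populationRisk f P) θstar := by
    filter_upwards [ball_mem_nhds θstar hS.rho_pos] with θ hθ
    rcases eq_or_ne θ θstar with rfl | hne
    · exact le_rfl
    · exact (hR.unique_min θ (hS.ball_subset hθ) hne).le
  simp [gradient, hmin.fderiv_eq_zero]

/-! ### Deterministic analysis of a minimizer -/

/-- Localization of a constrained minimizer of a convex function whose gradient satisfies a
quadratic expansion about an interior point. -/
lemma norm_minimizer_sub_le {d : ℕ} {F : Vec d → ℝ} {Θ : Set (Vec d)} {θ₀ θ₁ : Vec d}
    {ρ δ l lam : ℝ} (hF : ConvexOn ℝ Θ F) (hball : ball θ₀ ρ ⊆ Θ) (hθ₁ : θ₁ ∈ Θ)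
    (hmin : IsMinOn F Θ θ₁) {D : Vec d → Vec d}
    (hD : ∀ θ ∈ ball θ₀ ρ, HasGradientAt F (D θ) θ) {A : Vec d →L[ℝ] Vec d}
    (hA : ∀ v, 3 / 4 * lam * ‖v‖ ^ 2 ≤ inner ℝ (A v) v)
    (hexp : ∀ θ ∈ ball θ₀ ρ, ‖D θ - D θ₀ - A (θ - θ₀)‖ ≤ l * ‖θ - θ₀‖ ^ 2)
    (hlam : 0 < lam) (hl : 0 ≤ l) (hδ : 0 < δ) (hδρ : δ < ρ) (hlδ : l * δ ≤ lam / 4)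
    (hg : ‖D θ₀‖ < lam * δ / 2) :
    ‖θ₁ - θ₀‖ ≤ 2 * ‖D θ₀‖ / lam ∧ ‖D θ₀ + A (θ₁ - θ₀)‖ ≤ l * ‖θ₁ - θ₀‖ ^ 2 := by
  have hρ : 0 < ρ := hδ.trans hδρ
  have hθ₀ : θ₀ ∈ Θ := hball (mem_ball_self hρ)
  set v := θ₁ - θ₀ with hv
  have hseg (t : ℝ) (ht0 : 0 ≤ t) (ht1 : t ≤ 1) : θ₀ + t • v ∈ Θ := by
    have := hF.1 hθ₀ hθ₁ (sub_nonneg.2 ht1) ht0 (by ring)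
    convert this using 1
    rw [hv, smul_sub, sub_smul, one_smul]; abel
  -- The Taylor bound is useful only within `δ` of `θ₀`, where `θ₁` is not yet known to lie. So the
  -- estimate is first made at a point of the segment from `θ₀` to `θ₁`; taking `t = δ / ‖v‖` later
  -- rules out `‖v‖ > δ`.
  have key (t : ℝ) (ht0 : 0 < t) (ht1 : t ≤ 1) (htδ : t * ‖v‖ ≤ δ) :
      t * ‖v‖ ≤ 2 * ‖D θ₀‖ / lam := by
    have hmem : θ₀ + t • v ∈ ball θ₀ ρ := by
      rw [mem_ball_iff_norm, add_sub_cancel_left, norm_smul, Real.norm_of_nonneg ht0.le]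
      linarith
    -- A convex function on a segment decreases towards its minimizer at the end, so left difference
    -- quotients are nonpositive. Left ones are used because they stay on the segment even at `t =
    -- 1`.
    have hle : inner ℝ (D (θ₀ + t • v)) v ≤ 0 := by
      have hline : HasDerivAt (fun s : ℝ => θ₀ + s • v) v t := by
        simpa using ((hasDerivAt_id t).smul_const v).const_add θ₀
      have hder : HasDerivAt (fun s : ℝ => F (θ₀ + s • v)) (inner ℝ (D (θ₀ + t • v)) v) t := by
        have := (hD _ hmem).hasFDerivAt.comp_hasDerivAt t hline
        rwa [InnerProductSpace.toDual_apply_apply] at this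
      have hslope := (hasDerivAt_iff_tendsto_slope.1 hder).mono_left
        (nhdsWithin_mono t (show Set.Iio t ⊆ {t}ᶜ from fun s hs => ne_of_lt hs))
      refine le_of_tendsto hslope ?_
      filter_upwards [Ioo_mem_nhdsLT ht0] with s hs
      rw [slope_def_field]
      refine div_nonpos_of_nonneg_of_nonpos ?_ (by linarith [hs.2])
      have hs1 : 0 < 1 - s := by linarith [hs.2]
      have hconv := hF.2 (hseg s hs.1.le (by linarith [hs.2])) hθ₁
        (show 0 ≤ (1 - t) / (1 - s) from div_nonneg (by linarith) hs1.le)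
        (show 0 ≤ (t - s) / (1 - s) from div_nonneg (by linarith [hs.2]) hs1.le)
        (by field_simp; ring)
      have hpt : ((1 - t) / (1 - s)) • (θ₀ + s • v) + ((t - s) / (1 - s)) • θ₁
          = θ₀ + t • v := by
        have hθ : θ₁ = θ₀ + v := by rw [hv]; abel
        rw [hθ]
        have e1 : (1 - t) / (1 - s) + (t - s) / (1 - s) = 1 := by field_simp; ring
        have e2 : (1 - t) / (1 - s) * s + (t - s) / (1 - s) = t := by field_simp; ring
        calc _ = ((1 - t) / (1 - s) + (t - s) / (1 - s)) • θ₀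
              + ((1 - t) / (1 - s) * s + (t - s) / (1 - s)) • v := by module
          _ = _ := by rw [e1, e2, one_smul]
      rw [hpt] at hconv
      have hm : F θ₁ ≤ F (θ₀ + s • v) := hmin (hseg s hs.1.le (by linarith [hs.2]))
      have hb : (0 : ℝ) ≤ (t - s) / (1 - s) := div_nonneg (by linarith [hs.2]) hs1.le
      have e1 : (1 - t) / (1 - s) = 1 - (t - s) / (1 - s) := by field_simp; ring
      rw [e1] at hconv
      simp only [smul_eq_mul] at hconv
      nlinarith
    set u := t • v with hu
    have hun : ‖u‖ = t * ‖v‖ := by rw [hu, norm_smul, Real.norm_of_nonneg ht0.le]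
    have hle' : inner ℝ (D (θ₀ + u)) u ≤ 0 := by
      rw [hu, inner_smul_right]
      exact mul_nonpos_of_nonneg_of_nonpos ht0.le hle
    have h1 := hexp _ hmem
    rw [add_sub_cancel_left] at h1
    have h2 : inner ℝ (D (θ₀ + u)) u = inner ℝ (D (θ₀ + u) - D θ₀ - A u) u
        + inner ℝ (D θ₀) u + inner ℝ (A u) u := by
      simp only [inner_sub_left]; ring
    have h3 := neg_le_of_abs_le (abs_real_inner_le_norm (D (θ₀ + u) - D θ₀ - A u) u)
    have h4 := neg_le_of_abs_le (abs_real_inner_le_norm (D θ₀) u)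
    have h5 := hA u
    have h6 : ‖D (θ₀ + u) - D θ₀ - A u‖ * ‖u‖ ≤ lam / 4 * ‖u‖ ^ 2 := by
      calc _ ≤ (l * ‖u‖ ^ 2) * ‖u‖ := by gcongr
        _ = (l * ‖u‖) * ‖u‖ ^ 2 := by ring
        _ ≤ (l * δ) * ‖u‖ ^ 2 := by gcongr; rw [hun]; exact htδ
        _ ≤ _ := by gcongr
    -- Of the coercivity `3/4 * lam`, the Taylor remainder consumes `lam / 4`.
    have h7 : lam / 2 * ‖u‖ ^ 2 ≤ ‖D θ₀‖ * ‖u‖ := by nlinarith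
    rw [← hun, le_div_iff₀ hlam]
    rcases (norm_nonneg u).eq_or_lt with h0 | hpos
    · rw [← h0, zero_mul]; positivity
    · have : lam / 2 * ‖u‖ ≤ ‖D θ₀‖ := le_of_mul_le_mul_right (by linarith) hpos
      linarith
  have hb : 2 * ‖D θ₀‖ / lam < δ := by rw [div_lt_iff₀ hlam]; linarith
  have hvδ : ‖v‖ ≤ δ := by
    by_contra! hcon
    have hvpos : 0 < ‖v‖ := hδ.trans hcon
    have := key (δ / ‖v‖) (by positivity) ((div_le_one hvpos).2 hcon.le)
      (by rw [div_mul_cancel₀ _ hvpos.ne'])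
    rw [div_mul_cancel₀ _ hvpos.ne'] at this
    linarith
  have hv2 := key 1 one_pos le_rfl (by simpa using hvδ)
  rw [one_mul] at hv2
  refine ⟨hv2, ?_⟩
  have hmem : θ₁ ∈ ball θ₀ ρ := by rw [mem_ball_iff_norm]; exact hvδ.trans_lt hδρ
  have hD1 : D θ₁ = 0 := by
    have hloc : IsLocalMin F θ₁ :=
      IsMinOn.isLocalMin hmin (Filter.mem_of_superset (isOpen_ball.mem_nhds hmem) hball)
    have := hloc.hasFDerivAt_eq_zero (hD θ₁ hmem).hasFDerivAt
    simpa using this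
  have h := hexp θ₁ hmem
  rw [hD1] at h
  have e : (0 : Vec d) - D θ₀ - A (θ₁ - θ₀) = -(D θ₀ + A (θ₁ - θ₀)) := by abel
  rwa [e, norm_neg] at h

/-- A coercive operator has a left inverse of norm at most the inverse of its coercivity
constant. -/
lemma exists_leftInverse_of_coercive {V : Type*} [NormedAddCommGroup V] [InnerProductSpace ℝ V]
    [FiniteDimensional ℝ V] {A : V →L[ℝ] V} {lam : ℝ} (hlam : 0 < lam)
    (hA : ∀ v, lam * ‖v‖ ^ 2 ≤ inner ℝ (A v) v) :
    ∃ J : V →L[ℝ] V, (∀ v, J (A v) = v) ∧ ∀ v, ‖J v‖ ≤ ‖v‖ / lam := by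
  have hbound (v : V) : lam * ‖v‖ ≤ ‖A v‖ := by
    rcases (norm_nonneg v).eq_or_lt with h0 | hpos
    · rw [← h0, mul_zero]; positivity
    · have := (hA v).trans (real_inner_le_norm (A v) v)
      exact le_of_mul_le_mul_right (by linarith) hpos
  have hinj : Function.Injective (A : V →ₗ[ℝ] V) := by
    rw [injective_iff_map_eq_zero]
    intro v hv
    have h := hbound v
    have hv' : A v = 0 := hv
    rw [hv', norm_zero] at h
    exact norm_le_zero_iff.1 (nonpos_of_mul_nonpos_right h hlam)
  let e := LinearEquiv.ofInjectiveEndo (A : V →ₗ[ℝ] V) hinj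
  refine ⟨LinearMap.toContinuousLinearMap (e.symm : V →ₗ[ℝ] V), fun v => ?_, fun v => ?_⟩
  · exact e.symm_apply_apply v
  · rw [le_div_iff₀' hlam]
    have h := hbound (e.symm v)
    have h2 : A (e.symm v) = v := e.apply_symm_apply v
    rwa [h2] at h

/-- Deterministic error bounds for a minimizer, in terms of the total deviation
`‖g‖ + ‖B‖ + |ε|` of the gradient, the Hessian and the Lipschitz constant. -/
lemma exists_deviation_bounds {V : Type*} [NormedAddCommGroup V] [NormedSpace ℝ V]
    {lam R κ L : ℝ} (hlam : 0 < lam) (hR : 0 ≤ R) (hκ : 0 < κ) (hL : 0 ≤ L) :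
    ∃ C : ℝ, 0 ≤ C ∧ ∀ (D g : V) (A B J : V →L[ℝ] V) (l ε : ℝ), 0 ≤ l → l ≤ L →
      (∀ v, J (A v) = v) → (∀ v, ‖J v‖ ≤ ‖v‖ / lam) → ‖D‖ ≤ R →
      (‖g‖ < κ → ‖B‖ ≤ lam / 4 → |ε| ≤ 1 →
        ‖D‖ ≤ 2 * ‖g‖ / lam ∧ ‖g + (A - B) D‖ ≤ (l + ε) * ‖D‖ ^ 2) →
      ‖D + J g‖ ≤ C * (‖g‖ + ‖B‖ + |ε|) ^ 2 ∧
      ‖D + J g + J (B (J g))‖ ≤ L / lam * ‖D‖ ^ 2 + C * (‖g‖ + ‖B‖ + |ε|) ^ 3 := by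
  -- If `q < b`, all three smallness conditions hold; otherwise `1 ≤ q / b`, and constants can be
  -- multiplied by powers of `q / b`. In `c₂` and `c₃` the last bracket pays for this second case.
  set b := min κ (min (lam / 4) 1) with hbdef
  have hb : 0 < b := by positivity
  set c₁ := 2 / lam with hc₁
  set c₂ := (c₁ + (L + 1) * c₁ ^ 2) / lam + (R / b ^ 2 + 1 / (b * lam)) with hc₂
  set c₃ := c₂ / lam + c₁ ^ 2 / lam + (R / b ^ 3 + 1 / (lam * b ^ 2) + R / (lam * b ^ 2)) with hc₃
  have hc₁0 : 0 ≤ c₁ := by positivity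
  have hc₂0 : 0 ≤ c₂ := by positivity
  refine ⟨max c₂ c₃, le_max_of_le_left hc₂0, ?_⟩
  intro D g A B J l ε hl hlL hJA hJ hD hgood
  set q := ‖g‖ + ‖B‖ + |ε| with hq
  have hq0 : 0 ≤ q := by positivity
  have hgq : ‖g‖ ≤ q := by rw [hq]; linarith [norm_nonneg B, abs_nonneg ε]
  have hBq : ‖B‖ ≤ q := by rw [hq]; linarith [norm_nonneg g, abs_nonneg ε]
  have hεq : |ε| ≤ q := by rw [hq]; linarith [norm_nonneg g, norm_nonneg B]
  set s := g + (A - B) D with hs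
  have hJs : J s = D + J g - J (B D) := by
    rw [hs, sub_apply, map_add, map_sub, hJA]; abel
  have hr : D + J g = J (B D) + J s := by rw [hJs]; abel
  -- The second-order bound on `D + J g`, multiplied by `B`, becomes third order.
  have he : D + J g + J (B (J g)) = J (B (D + J g)) + J s := by
    rw [hJs, map_add B, map_add J]; abel
  have hJB (v : V) : ‖J (B v)‖ ≤ ‖B‖ * ‖v‖ / lam :=
    (hJ _).trans (by gcongr; exact B.le_opNorm v)
  have main : ‖D + J g‖ ≤ c₂ * q ^ 2 ∧
      ‖J s‖ ≤ L / lam * ‖D‖ ^ 2 + (c₃ - c₂ / lam) * q ^ 3 := by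
    by_cases hG : ‖g‖ < κ ∧ ‖B‖ ≤ lam / 4 ∧ |ε| ≤ 1
    · obtain ⟨h1, h2⟩ := hgood hG.1 hG.2.1 hG.2.2
      have hDq : ‖D‖ ≤ c₁ * q := by
        refine h1.trans ?_
        rw [hc₁, div_mul_eq_mul_div]; gcongr
      have hD2 : ‖D‖ ^ 2 ≤ c₁ ^ 2 * q ^ 2 := by rw [← mul_pow]; gcongr
      have hJs1 : ‖J s‖ ≤ (l + ε) * ‖D‖ ^ 2 / lam := (hJ s).trans (by gcongr)
      constructor
      · calc ‖D + J g‖ ≤ ‖J (B D)‖ + ‖J s‖ := by rw [hr]; exact norm_add_le _ _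
          _ ≤ ‖B‖ * ‖D‖ / lam + (l + ε) * ‖D‖ ^ 2 / lam := add_le_add (hJB D) hJs1
          _ ≤ q * (c₁ * q) / lam + (L + 1) * (c₁ ^ 2 * q ^ 2) / lam := by
              gcongr
              exact (le_abs_self ε).trans hG.2.2
          _ = (c₁ + (L + 1) * c₁ ^ 2) / lam * q ^ 2 := by ring
          _ ≤ c₂ * q ^ 2 := by
              gcongr
              rw [hc₂]
              exact le_add_of_nonneg_right (by positivity)
      · calc ‖J s‖ ≤ (l + ε) * ‖D‖ ^ 2 / lam := hJs1
          _ = l / lam * ‖D‖ ^ 2 + ε * ‖D‖ ^ 2 / lam := by ring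
          _ ≤ L / lam * ‖D‖ ^ 2 + q * (c₁ ^ 2 * q ^ 2) / lam := by
              gcongr
              exact (le_abs_self ε).trans hεq
          _ = L / lam * ‖D‖ ^ 2 + c₁ ^ 2 / lam * q ^ 3 := by ring
          _ ≤ _ := by
              gcongr
              rw [hc₃]
              have : 0 ≤ R / b ^ 3 + 1 / (lam * b ^ 2) + R / (lam * b ^ 2) := by positivity
              linarith
    · have hbq : b ≤ q := by
        by_contra! hcon
        refine hG ⟨(hgq.trans_lt hcon).trans_le (min_le_left _ _), ?_, ?_⟩
        · exact (hBq.trans hcon.le).trans ((min_le_right _ _).trans (min_le_left _ _))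
        · exact (hεq.trans hcon.le).trans ((min_le_right _ _).trans (min_le_right _ _))
      have hqb : 1 ≤ q / b := (one_le_div hb).2 hbq
      have hqb2 : 1 ≤ (q / b) ^ 2 := one_le_pow₀ hqb
      have hqb3 : 1 ≤ (q / b) ^ 3 := one_le_pow₀ hqb
      have hDg : ‖D + J g‖ ≤ R + q / lam :=
        (norm_add_le _ _).trans (add_le_add hD ((hJ g).trans (by gcongr)))
      constructor
      · calc ‖D + J g‖ ≤ R * 1 + q / lam * 1 := by simpa using hDg
          _ ≤ R * (q / b) ^ 2 + q / lam * (q / b) := by gcongr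
          _ = (R / b ^ 2 + 1 / (b * lam)) * q ^ 2 := by field_simp
          _ ≤ c₂ * q ^ 2 := by
              gcongr
              rw [hc₂]
              exact le_add_of_nonneg_left (by positivity)
      · calc ‖J s‖ ≤ ‖D + J g‖ + ‖J (B D)‖ := by rw [hJs]; exact norm_sub_le _ _
          _ ≤ (R + q / lam) + q * R / lam := by
              refine add_le_add hDg ((hJB D).trans ?_)
              gcongr
          _ = R * 1 + q / lam * 1 + q * R / lam * 1 := by ring
          _ ≤ R * (q / b) ^ 3 + q / lam * (q / b) ^ 2 + q * R / lam * (q / b) ^ 2 := by gcongr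
          _ = (R / b ^ 3 + 1 / (lam * b ^ 2) + R / (lam * b ^ 2)) * q ^ 3 := by field_simp
          _ ≤ (c₃ - c₂ / lam) * q ^ 3 := by
              gcongr
              rw [hc₃]
              have : 0 ≤ c₁ ^ 2 / lam := by positivity
              linarith
          _ ≤ _ := le_add_of_nonneg_left (by positivity)
  obtain ⟨h1, h2⟩ := main
  refine ⟨h1.trans (by gcongr; exact le_max_left _ _), ?_⟩
  rw [he]
  calc ‖J (B (D + J g)) + J s‖ ≤ ‖B‖ * ‖D + J g‖ / lam + ‖J s‖ :=
        (norm_add_le _ _).trans (add_le_add (hJB _) le_rfl)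
    _ ≤ q * (c₂ * q ^ 2) / lam + (L / lam * ‖D‖ ^ 2 + (c₃ - c₂ / lam) * q ^ 3) := by gcongr
    _ = L / lam * ‖D‖ ^ 2 + c₃ * q ^ 3 := by ring
    _ ≤ _ := by gcongr; exact le_max_right _ _

/-! ### Expectations and averaging -/

/-- Passage to expectations: second moment and bias of an estimator whose error `D` is
approximated to second and third order in deviations with fourth moment `O(n⁻²)`. -/
lemma moment_bounds_of_deviation_bounds {V : Type*} [NormedAddCommGroup V] [NormedSpace ℝ V]
    [CompleteSpace V] {Ω : Type*} [MeasurableSpace Ω] {ν : Measure Ω} [IsProbabilityMeasure ν]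
    {D g : Ω → V} {B : Ω → V →L[ℝ] V} {ε : Ω → ℝ} {J : V →L[ℝ] V} {lam L G β C A R : ℝ} {n : ℕ}
    (hn : 1 ≤ n) (hlam : 0 < lam) (hL : 0 ≤ L) (hC : 0 ≤ C) (hA : 0 ≤ A)
    (hJ : ∀ v, ‖J v‖ ≤ ‖v‖ / lam) (hDm : AEStronglyMeasurable D ν) (hDR : ∀ᵐ ω ∂ν, ‖D ω‖ ≤ R)
    (hg : MemLp g 4 ν) (hB : MemLp B 4 ν) (hε : MemLp ε 4 ν)
    (h2 : ∀ᵐ ω ∂ν, ‖D ω + J (g ω)‖ ≤ C * (‖g ω‖ + ‖B ω‖ + |ε ω|) ^ 2)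
    (h3 : ∀ᵐ ω ∂ν, ‖D ω + J (g ω) + J (B ω (J (g ω)))‖
      ≤ L / lam * ‖D ω‖ ^ 2 + C * (‖g ω‖ + ‖B ω‖ + |ε ω|) ^ 3)
    (hq : ∫ ω, (‖g ω‖ + ‖B ω‖ + |ε ω|) ^ 4 ∂ν ≤ A / n ^ 2)
    (hg2 : ∫ ω, ‖g ω‖ ^ 2 ∂ν ≤ G ^ 2 / n) (hg0 : ∫ ω, g ω ∂ν = 0)
    (hβ : ‖∫ ω, J (B ω (J (g ω))) ∂ν‖ ≤ β / n) :
    ∫ ω, ‖D ω‖ ^ 2 ∂ν ≤ 2 * G ^ 2 / (lam ^ 2 * n) + 2 * C ^ 2 * A / n ^ 2 ∧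
    ‖∫ ω, D ω ∂ν‖ ≤ (β + 2 * L * G ^ 2 / lam ^ 3) / n
      + (L / lam * (2 * C ^ 2 * A) + C * (A + 1)) / (n * Real.sqrt n) := by
  have hn1 : (1 : ℝ) ≤ n := by exact_mod_cast hn
  have hn0 : (0 : ℝ) < n := by linarith
  have ipow {u : Ω → ℝ} (hu : MemLp u 4 ν) (k : ℕ) (hk : k ≤ 4) :
      Integrable (fun x => u x ^ k) ν := by
    have h := (hu.mono_exponent (by exact_mod_cast hk : (k : ENNReal) ≤ 4)).integrable_norm_pow'
    refine (integrable_norm_iff (hu.1.pow k)).1 (h.congr (.of_forall fun x => ?_))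
    simp
  set q : Ω → ℝ := fun ω => ‖g ω‖ + ‖B ω‖ + |ε ω| with hqdef
  have hqm : MemLp q 4 ν := (hg.norm.add hB.norm).add hε.norm
  have hq0 (ω) : 0 ≤ q ω := by positivity
  have hDbd : MemLp D 4 ν := MemLp.of_bound hDm R hDR
  have iD2 : Integrable (fun ω => ‖D ω‖ ^ 2) ν := ipow hDbd.norm 2 (by norm_num)
  have ig2 : Integrable (fun ω => ‖g ω‖ ^ 2) ν := ipow hg.norm 2 (by norm_num)
  have iq4 := ipow hqm 4 le_rfl
  have iq3 := ipow hqm 3 (by norm_num)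
  have hJg : MemLp (fun ω => J (g ω)) 4 ν := J.comp_memLp' hg
  have iBJ : Integrable (fun ω => J (B ω (J (g ω)))) ν := by
    refine J.integrable_comp ?_
    exact integrable_bilin_of_memLp_two (ContinuousLinearMap.id ℝ (V →L[ℝ] V))
      (hB.mono_exponent (by norm_num)) (hJg.mono_exponent (by norm_num))
  have hD2 : ∫ ω, ‖D ω‖ ^ 2 ∂ν ≤ 2 * G ^ 2 / (lam ^ 2 * n) + 2 * C ^ 2 * A / n ^ 2 := by
    calc ∫ ω, ‖D ω‖ ^ 2 ∂ν
        ≤ ∫ ω, (2 / lam ^ 2 * ‖g ω‖ ^ 2 + 2 * C ^ 2 * q ω ^ 4) ∂ν := by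
          refine integral_mono_ae iD2 ((ig2.const_mul _).add (iq4.const_mul _)) ?_
          filter_upwards [h2] with ω hω
          have h1 : ‖D ω‖ ≤ ‖D ω + J (g ω)‖ + ‖J (g ω)‖ := by
            simpa using norm_sub_le (D ω + J (g ω)) (J (g ω))
          have h4 : ‖D ω‖ ≤ C * q ω ^ 2 + ‖g ω‖ / lam := h1.trans (add_le_add hω (hJ _))
          calc ‖D ω‖ ^ 2 ≤ (C * q ω ^ 2 + ‖g ω‖ / lam) ^ 2 := by gcongr
            _ ≤ 2 * ((C * q ω ^ 2) ^ 2 + (‖g ω‖ / lam) ^ 2) := add_sq_le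
            _ = _ := by ring
      _ = 2 / lam ^ 2 * ∫ ω, ‖g ω‖ ^ 2 ∂ν + 2 * C ^ 2 * ∫ ω, q ω ^ 4 ∂ν := by
          rw [integral_add (ig2.const_mul _) (iq4.const_mul _), integral_const_mul,
            integral_const_mul]
      _ ≤ 2 / lam ^ 2 * (G ^ 2 / n) + 2 * C ^ 2 * (A / n ^ 2) := by gcongr
      _ = _ := by field_simp
  refine ⟨hD2, ?_⟩
  set w := Real.sqrt n with hw
  have hw0 : 0 < w := Real.sqrt_pos.2 hn0
  have hw2 : w ^ 2 = n := Real.sq_sqrt hn0.le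
  have hw1 : 1 ≤ w := Real.one_le_sqrt.2 hn1
  -- Split according to whether `q` exceeds its typical size `1 / w = n^(-1/2)`: above it `q³ ≤ w
  -- q⁴`, below it `q³ ≤ w⁻³`.
  have hq3 : ∫ ω, q ω ^ 3 ∂ν ≤ (A + 1) / (n * w) := by
    calc ∫ ω, q ω ^ 3 ∂ν ≤ ∫ ω, (w * q ω ^ 4 + 1 / (n * w)) ∂ν := by
          refine integral_mono iq3 ((iq4.const_mul _).add (integrable_const _)) fun ω => ?_
          change q ω ^ 3 ≤ w * q ω ^ 4 + 1 / (n * w)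
          rw [← hw2]
          have hx := hq0 ω
          rcases le_total (1 / w) (q ω) with h | h
          · have : 1 ≤ w * q ω := by rwa [div_le_iff₀' hw0] at h
            have h5 : q ω ^ 3 * 1 ≤ q ω ^ 3 * (w * q ω) := by gcongr
            have h6 : 0 ≤ 1 / (w ^ 2 * w) := by positivity
            linarith
          · have h5 : q ω ^ 3 ≤ (1 / w) ^ 3 := by gcongr
            have h6 : (1 / w) ^ 3 = 1 / (w ^ 2 * w) := by rw [div_pow, one_pow]; ring
            have h7 : 0 ≤ w * q ω ^ 4 := by positivity
            linarith
      _ = w * ∫ ω, q ω ^ 4 ∂ν + 1 / (n * w) := by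
          rw [integral_add (iq4.const_mul _) (integrable_const _), integral_const_mul]
          simp
      _ ≤ w * (A / n ^ 2) + 1 / (n * w) := by gcongr
      _ = _ := by rw [← hw2]; field_simp
  have hsplit : ∫ ω, D ω ∂ν = ∫ ω, (D ω + J (g ω) + J (B ω (J (g ω)))) ∂ν
      - ∫ ω, J (B ω (J (g ω))) ∂ν := by
    have iD := hDbd.integrable (by norm_num)
    have iJ := hJg.integrable (by norm_num)
    have iDJ : Integrable (fun ω => D ω + J (g ω)) ν := iD.add iJ
    rw [integral_add iDJ iBJ, integral_add iD iJ,
      J.integral_comp_comm (hg.integrable (by norm_num)), hg0, map_zero]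
    abel
  have herr : ‖∫ ω, (D ω + J (g ω) + J (B ω (J (g ω)))) ∂ν‖
      ≤ L / lam * ∫ ω, ‖D ω‖ ^ 2 ∂ν + C * ∫ ω, q ω ^ 3 ∂ν := by
    rw [← integral_const_mul, ← integral_const_mul,
      ← integral_add (iD2.const_mul _) (iq3.const_mul _)]
    exact norm_integral_le_of_norm_le ((iD2.const_mul _).add (iq3.const_mul _)) h3
  have hn2 : 2 * C ^ 2 * A / (n : ℝ) ^ 2 ≤ 2 * C ^ 2 * A / (n * w) := by
    gcongr
    rw [pow_two]
    gcongr
    rw [← hw2]; nlinarith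
  rw [hsplit]
  calc _ ≤ (L / lam * (2 * G ^ 2 / (lam ^ 2 * n) + 2 * C ^ 2 * A / (n * w))
          + C * ((A + 1) / (n * w))) + β / n := by
        refine (norm_sub_le _ _).trans (add_le_add (herr.trans ?_) hβ)
        gcongr
        exact hD2.trans (by gcongr)
    _ = _ := by field_simp; ring

/-- Averaging independent estimators: the variance is divided by their number. -/
lemma integral_norm_avg_sq_le {V : Type*} [NormedAddCommGroup V] [InnerProductSpace ℝ V]
    [CompleteSpace V] {Ω : Type*} [MeasurableSpace Ω] {ν : Measure Ω} [IsProbabilityMeasure ν]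
    {m : ℕ} (hm : 1 ≤ m) {Z : Fin m → Ω → V} (hZ : ∀ i, MemLp (Z i) 2 ν) {a b : ℝ} (hb : 0 ≤ b)
    (ha : ∀ i, ∫ ω, ‖Z i ω‖ ^ 2 ∂ν ≤ a) (hb' : ∀ i, ‖∫ ω, Z i ω ∂ν‖ ^ 2 ≤ b) :
    MemLp (fun S : Fin m → Ω => (1 / (m : ℝ)) • ∑ i, Z i (S i)) 2 (Measure.pi fun _ => ν) ∧
    ∫ S : Fin m → Ω, ‖(1 / (m : ℝ)) • ∑ i, Z i (S i)‖ ^ 2 ∂(Measure.pi fun _ => ν)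
      ≤ a / m + b := by
  have hm0 : (0 : ℝ) < m := by exact_mod_cast hm
  have hmem (i) : MemLp (fun S : Fin m → Ω => Z i (S i)) 2 (Measure.pi fun _ => ν) :=
    memLp_eval (hZ i) i
  refine ⟨(memLp_finsetSum _ fun i _ => hmem i).const_smul _, ?_⟩
  have hint (i j : Fin m) : Integrable (fun S : Fin m → Ω => inner ℝ (Z i (S i)) (Z j (S j)))
      (Measure.pi fun _ => ν) :=
    integrable_bilin_of_memLp_two (innerSL ℝ (E := V)) (hmem i) (hmem j)
  have hexp (S : Fin m → Ω) : ‖(1 / (m : ℝ)) • ∑ i, Z i (S i)‖ ^ 2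
      = (1 / (m : ℝ)) ^ 2 * ∑ i, ∑ j, inner ℝ (Z i (S i)) (Z j (S j)) := by
    rw [norm_smul, mul_pow, Real.norm_of_nonneg (by positivity), ← real_inner_self_eq_norm_sq]
    simp only [sum_inner, inner_sum]
    rw [Finset.sum_comm]
  -- Distinct machines contribute only the product of their biases; the extra `b` on the diagonal is
  -- harmless slack.
  have hpair (i j : Fin m) : ∫ S : Fin m → Ω, inner ℝ (Z i (S i)) (Z j (S j))
      ∂(Measure.pi fun _ => ν) ≤ (if i = j then a else 0) + b := by
    split_ifs with hij
    · subst hij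
      have e (S : Fin m → Ω) : inner ℝ (Z i (S i)) (Z i (S i)) = ‖Z i (S i)‖ ^ 2 :=
        real_inner_self_eq_norm_sq _
      rw [integral_congr_ae (.of_forall e)]
      have := integral_eval (ι := Fin m) (Z := fun ω => ‖Z i ω‖ ^ 2) ((hZ i).1.norm.pow 2) i
      linarith [ha i]
    · have : ∫ S : Fin m → Ω, inner ℝ (Z i (S i)) (Z j (S j)) ∂(Measure.pi fun _ => ν)
          = inner ℝ (∫ ω, Z i ω ∂ν) (∫ ω, Z j ω ∂ν) :=
        integral_bilin_eval_of_ne (innerSL ℝ (E := V)) ((hZ i).integrable (by norm_num))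
          ((hZ j).integrable (by norm_num)) hij
      rw [this, zero_add]
      refine (real_inner_le_norm _ _).trans ?_
      nlinarith [hb' i, hb' j, sq_nonneg (‖∫ ω, Z i ω ∂ν‖ - ‖∫ ω, Z j ω ∂ν‖)]
  simp only [hexp]
  rw [integral_const_mul, integral_finsetSum _ fun i _ => integrable_finsetSum _ fun j _ => hint i j]
  simp_rw [integral_finsetSum _ fun j _ => hint _ j]
  calc _ ≤ (1 / (m : ℝ)) ^ 2 * ∑ i : Fin m, ∑ j : Fin m, ((if i = j then a else 0) + b) := by
        gcongr with i _ j _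
        exact hpair i j
    _ = _ := by
        simp [Finset.sum_add_distrib]
        field_simp

lemma integral_norm_sum_sq {X V : Type*} [MeasurableSpace X] {P : Measure X}
    [IsProbabilityMeasure P] [NormedAddCommGroup V] [InnerProductSpace ℝ V] [CompleteSpace V]
    {ι : Type*} [Fintype ι] {Z : X → V} (hZ : MemLp Z 2 P) (hZ0 : ∫ x, Z x ∂P = 0) :
    ∫ S : ι → X, ‖∑ j, Z (S j)‖ ^ 2 ∂(Measure.pi fun _ => P)
      = Fintype.card ι * ∫ x, ‖Z x‖ ^ 2 ∂P := by
  classical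
  have h : ∫ S : ι → X, inner ℝ (∑ j, Z (S j)) (∑ j, Z (S j)) ∂(Measure.pi fun _ => P)
      = (Fintype.card ι : ℝ) • ∫ x, inner ℝ (Z x) (Z x) ∂P :=
    integral_bilin_sum (innerSL ℝ (E := V)) hZ hZ hZ0
  simpa only [real_inner_self_eq_norm_sq, smul_eq_mul] using h

lemma memLp_avg {X E : Type*} [MeasurableSpace X] {P : Measure X} [IsProbabilityMeasure P]
    [NormedAddCommGroup E] [NormedSpace ℝ E] {Z : X → E} {p : ENNReal} (hZ : MemLp Z p P) (n : ℕ) :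
    MemLp (fun S : Fin n → X => (1 / (n : ℝ)) • ∑ j, Z (S j)) p (sampleLaw P n) := by
  have h : MemLp (fun S : Fin n → X => ∑ j, Z (S j)) p (sampleLaw P n) :=
    memLp_finsetSum _ fun j _ => memLp_eval hZ j
  exact h.const_smul (1 / (n : ℝ))

/-! ### The empirical minimizer of one data set -/

/-- The deterministic localization of the empirical minimizer on the event that the empirical
gradient is small and the empirical Lipschitz constant of the Hessian is bounded. -/
lemma norm_empiricalMinimizer_sub_le {d n : ℕ} {X : Type*} [MeasurableSpace X] {P : Measure X}
    {f : Vec d → X → ℝ} {Θ : Set (Vec d)} {θstar : Vec d} {ρ G H L lam : ℝ}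
    (hR : RiskProblem f P Θ θstar) (hS : SmoothnessAssumption f P Θ θstar ρ G H L)
    (hΘ : Convex ℝ Θ) (hlam : 0 < lam) (hn : 1 ≤ n)
    {Lip : X → ℝ} (hLip0 : ∀ x, 0 ≤ Lip x)
    (hLip : ∀ x, ∀ θ ∈ ball θstar ρ,
      ‖hessian (fun η => f η x) θ - hessian (fun η => f η x) θstar‖ ≤ Lip x * ‖θ - θstar‖)
    {A : Vec d →L[ℝ] Vec d} (hA : ∀ v, lam * ‖v‖ ^ 2 ≤ inner ℝ (A v) v) {S : Fin n → X}
    {θ₁ : Vec d} (hθ₁ : θ₁ ∈ Θ) (hmin : IsMinOn (empiricalRisk f S) Θ θ₁) {δ : ℝ} (hδ : 0 < δ)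
    (hδρ : δ < ρ) (hlδ : ((1 / (n : ℝ)) • ∑ j, Lip (S j)) * δ ≤ lam / 4)
    (hB : ‖(1 / (n : ℝ)) • ∑ j, (A - hessian (fun η => f η (S j)) θstar)‖ ≤ lam / 4)
    (hg : ‖(1 / (n : ℝ)) • ∑ j, gradient (fun η => f η (S j)) θstar‖ < lam * δ / 2) :
    ‖θ₁ - θstar‖ ≤ 2 * ‖(1 / (n : ℝ)) • ∑ j, gradient (fun η => f η (S j)) θstar‖ / lam ∧
    ‖(1 / (n : ℝ)) • ∑ j, gradient (fun η => f η (S j)) θstar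
      + (A - (1 / (n : ℝ)) • ∑ j, (A - hessian (fun η => f η (S j)) θstar)) (θ₁ - θstar)‖
      ≤ ((1 / (n : ℝ)) • ∑ j, Lip (S j)) * ‖θ₁ - θstar‖ ^ 2 := by
  have hn0 : (0 : ℝ) < n := by exact_mod_cast hn
  set B := (1 / (n : ℝ)) • ∑ j, (A - hessian (fun η => f η (S j)) θstar) with hBdef
  have hF : ConvexOn ℝ Θ (empiricalRisk f S) := by
    have : ConvexOn ℝ Θ (∑ j, fun θ => f θ (S j)) :=
      Finset.sum_induction _ (ConvexOn ℝ Θ) (fun _ _ => ConvexOn.add) (convexOn_const 0 hΘ)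
        fun j _ => hR.convex_loss (S j)
    have e : empiricalRisk f S = fun θ => (1 / (n : ℝ)) • (∑ j, fun θ => f θ (S j)) θ := by
      ext θ; simp [empiricalRisk]
    rw [e]
    exact this.smul (by positivity)
  have hAB : A - B = (1 / (n : ℝ)) • ∑ j, hessian (fun η => f η (S j)) θstar := by
    rw [hBdef, Finset.sum_sub_distrib, smul_sub]
    simp only [Finset.sum_const, Finset.card_univ, Fintype.card_fin]
    rw [← Nat.cast_smul_eq_nsmul ℝ, smul_smul, one_div_mul_cancel hn0.ne', one_smul]
    abel
  refine norm_minimizer_sub_le hF hS.ball_subset hθ₁ hmin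
    (D := fun θ => (1 / (n : ℝ)) • ∑ j, gradient (fun η => f η (S j)) θ) (A := A - B)
    (fun θ hθ => ?_) (fun v => ?_) (fun θ hθ => ?_) hlam ?_ hδ hδρ hlδ hg
  · have h : HasFDerivAt (fun η => ∑ j, f η (S j))
        (∑ j, fderiv ℝ (fun η => f η (S j)) θ) θ :=
      HasFDerivAt.fun_sum fun j _ => (hS.differentiable (S j) θ hθ).hasFDerivAt
    have h' := h.const_mul (1 / (n : ℝ))
    rw [hasGradientAt_iff_hasFDerivAt]
    have e : InnerProductSpace.toDual ℝ (Vec d)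
        ((1 / (n : ℝ)) • ∑ j, gradient (fun η => f η (S j)) θ)
        = (1 / (n : ℝ)) • ∑ j, fderiv ℝ (fun η => f η (S j)) θ := by
      simp [gradient]
    rw [e]
    exact h'
  -- The Hessian deviation costs at most `lam / 4`, leaving coercivity `3/4 * lam`.
  · have h1 := (abs_le.1 (abs_real_inner_le_norm (B v) v)).2
    have h2 : ‖B v‖ * ‖v‖ ≤ lam / 4 * ‖v‖ ^ 2 := by
      rw [pow_two, ← mul_assoc]
      gcongr
      exact (B.le_opNorm v).trans (by gcongr)
    rw [sub_apply, inner_sub_left]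
    linarith [hA v]
  · have e : (1 / (n : ℝ)) • ∑ j, gradient (fun η => f η (S j)) θ
        - (1 / (n : ℝ)) • ∑ j, gradient (fun η => f η (S j)) θstar - (A - B) (θ - θstar)
        = (1 / (n : ℝ)) • ∑ j, (gradient (fun η => f η (S j)) θ
          - gradient (fun η => f η (S j)) θstar
          - hessian (fun η => f η (S j)) θstar (θ - θstar)) := by
      rw [hAB, Finset.sum_sub_distrib, Finset.sum_sub_distrib, smul_sub, smul_sub, smul_apply,
        sum_apply]
    rw [e, norm_smul, Real.norm_of_nonneg (by positivity), smul_eq_mul, mul_assoc,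
      Finset.sum_mul]
    gcongr
    refine (norm_sum_le _ _).trans (Finset.sum_le_sum fun j _ => ?_)
    exact norm_gradient_sub_sub_le (hS.differentiable_gradient (S j)) (hLip0 _) (hLip (S j)) hθ
  · rw [smul_eq_mul]
    exact mul_nonneg (by positivity) (Finset.sum_nonneg fun j _ => hLip0 _)

lemma add_add_pow_four_le {a b c : ℝ} : (a + b + c) ^ 4 ≤ 27 * (a ^ 4 + b ^ 4 + c ^ 4) := by
  have h1 : (a + b + c) ^ 2 ≤ 3 * (a ^ 2 + b ^ 2 + c ^ 2) := by
    nlinarith [sq_nonneg (a - b), sq_nonneg (b - c), sq_nonneg (a - c)]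
  have h2 : (a ^ 2 + b ^ 2 + c ^ 2) ^ 2 ≤ 3 * (a ^ 4 + b ^ 4 + c ^ 4) := by
    nlinarith [sq_nonneg (a ^ 2 - b ^ 2), sq_nonneg (b ^ 2 - c ^ 2), sq_nonneg (a ^ 2 - c ^ 2)]
  calc (a + b + c) ^ 4 = ((a + b + c) ^ 2) ^ 2 := by ring
    _ ≤ (3 * (a ^ 2 + b ^ 2 + c ^ 2)) ^ 2 := by gcongr
    _ = 9 * (a ^ 2 + b ^ 2 + c ^ 2) ^ 2 := by ring
    _ ≤ _ := by linarith

/-- Second moment and bias of a single empirical minimizer. -/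
theorem exists_empiricalMinimizer_moment_bounds {d : ℕ} (hd : 1 ≤ d) {R lam ρ G H L : ℝ}
    (hR0 : 0 ≤ R) (hlam : 0 < lam) (hρ : 0 < ρ) (hG : 0 ≤ G) (hH : 0 ≤ H) (hL : 0 ≤ L) :
    ∃ C : ℝ, 0 ≤ C ∧
      ∀ (X : Type*) [MeasurableSpace X] (P : Measure X) [IsProbabilityMeasure P]
        (f : Vec d → X → ℝ) (Θ : Set (Vec d)) (θstar : Vec d),
        RiskProblem f P Θ θstar → ParameterAssumption Θ θstar R →
        LocalStrongConvexity f P Θ θstar lam → SmoothnessAssumption f P Θ θstar ρ G H L →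
        ∀ n : ℕ, 1 ≤ n → ∀ T : (Fin n → X) → Vec d, IsEmpiricalMinimizer f P Θ T →
          MemLp (fun S => T S - θstar) 2 (sampleLaw P n) ∧
          ∫ S, ‖T S - θstar‖ ^ 2 ∂(sampleLaw P n) ≤ 2 * G ^ 2 / (lam ^ 2 * n) + C / n ^ 2 ∧
          ‖∫ S, (T S - θstar) ∂(sampleLaw P n)‖
            ≤ (H * G / lam ^ 2 + 2 * L * G ^ 2 / lam ^ 3) / n + C / (n * Real.sqrt n) := by
  have : Nonempty (Fin d) := ⟨⟨0, hd⟩⟩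
  obtain ⟨K₁, hK₁, hmom₁⟩ := exists_integral_norm_avg_pow_four_le (Vec d)
  obtain ⟨K₂, hK₂, hmom₂⟩ := exists_integral_norm_avg_pow_four_le (Vec d →L[ℝ] Vec d)
  obtain ⟨K₃, hK₃, hmom₃⟩ := exists_integral_norm_avg_pow_four_le ℝ
  -- `L + 1` bounds the empirical Lipschitz constant when `|ε| ≤ 1`, so its product with `δ` is at
  -- most `lam / 4`; `ρ / 2` keeps `δ < ρ`.
  set δ := min (ρ / 2) (lam / (4 * (L + 1))) with hδdef
  have hδ : 0 < δ := by positivity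
  obtain ⟨C, hC, hdev⟩ := exists_deviation_bounds (V := Vec d) (lam := lam) (R := R)
    (κ := lam * δ / 2) (L := L) hlam hR0 (by positivity) hL
  set A := 27 * (K₁ * G ^ 4 + K₂ * H ^ 4 + K₃ * L ^ 4) with hAdef
  have hA : 0 ≤ A := by positivity
  refine ⟨2 * C ^ 2 * A + (L / lam * (2 * C ^ 2 * A) + C * (A + 1)), by positivity, ?_⟩
  intro X _ P _ f Θ θstar hR hΘ hlsc hS n hn T hT
  have hn0 : (0 : ℝ) < n := by exact_mod_cast hn
  have hmem : θstar ∈ ball θstar ρ := mem_ball_self hρ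
  obtain ⟨Lip, hLip, hle, hL8, hLc8⟩ := hS.hessian_lipschitz
  have hLip0 (x) : 0 ≤ Lip x := by
    obtain ⟨v, hv⟩ := exists_norm_eq (Vec d) (show 0 ≤ ρ / 2 by positivity)
    have h := (norm_nonneg _).trans (hle x θstar hmem (θstar + v)
      (by rw [mem_ball_iff_norm, add_sub_cancel_left, hv]; linarith))
    rw [add_sub_cancel_left, hv] at h
    exact nonneg_of_mul_nonneg_left h (by positivity)
  set M₀ := hessian (populationRisk f P) θstar with hM
  have hcoer (v) : lam * ‖v‖ ^ 2 ≤ inner ℝ (M₀ v) v := by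
    have h := hlsc.curvature.inner_nonneg_left v
    rw [sub_apply, inner_sub_left, smul_apply, ContinuousLinearMap.id_apply, real_inner_smul_left,
      real_inner_self_eq_norm_sq] at h
    linarith
  obtain ⟨J, hJM, hJ⟩ := exists_leftInverse_of_coercive hlam hcoer
  -- the i.i.d. summands
  let gx : X → Vec d := fun x => gradient (fun η => f η x) θstar
  let Bx : X → Vec d →L[ℝ] Vec d := fun x => M₀ - hessian (fun η => f η x) θstar
  let l := ∫ x, Lip x ∂P
  let εx : X → ℝ := fun x => Lip x - l
  have hgx8 : MemLp gx 8 P := hS.gradient_memLp θstar hmem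
  have hBx8 : MemLp Bx 8 P :=
    (hS.hessian_memLp θstar hmem).neg.ae_eq (.of_forall fun x => neg_sub _ _)
  have hεx8 : MemLp εx 8 P := hLip.sub (memLp_const l)
  have hgx4 : MemLp gx 4 P := hgx8.mono_exponent (by norm_num)
  have hBx4 : MemLp Bx 4 P := hBx8.mono_exponent (by norm_num)
  have hεx4 : MemLp εx 4 P := hεx8.mono_exponent (by norm_num)
  have hgx2 : MemLp gx 2 P := hgx8.mono_exponent (by norm_num)
  have hBx2 : MemLp Bx 2 P := hBx8.mono_exponent (by norm_num)
  have hgx0 : ∫ x, gx x ∂P = 0 :=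
    (gradient_populationRisk hR hS hmem).symm.trans (gradient_populationRisk_eq_zero hR hS)
  have hBx0 : ∫ x, Bx x ∂P = 0 := by
    have := hessian_populationRisk hR hS hmem
    rw [integral_sub (integrable_const _) ((hS.hessian_loss_memLp hmem).integrable (by norm_num)),
      ← this]
    simp [hM]
  have hεx0 : ∫ x, εx x ∂P = 0 := by
    rw [integral_sub (hLip.integrable (by norm_num)) (integrable_const _)]
    simp [l]
  have hBx8m : ∫ x, ‖Bx x‖ ^ 8 ∂P ≤ H ^ 8 := by
    refine le_of_eq_of_le ?_ (hS.hessian_moment θstar hmem)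
    exact integral_congr_ae (.of_forall fun x => by simp only [Bx, hM]; rw [norm_sub_rev])
  have hgx2m : ∫ x, ‖gx x‖ ^ 2 ∂P ≤ G ^ 2 :=
    integral_sq_le_of_pow_eight hgx8.norm (hS.gradient_moment θstar hmem)
  have hBx2m : ∫ x, ‖Bx x‖ ^ 2 ∂P ≤ H ^ 2 := integral_sq_le_of_pow_eight hBx8.norm hBx8m
  have hgx4m : ∫ x, ‖gx x‖ ^ 4 ∂P ≤ G ^ 4 :=
    integral_pow_four_le_of_pow_eight hgx8.norm (hS.gradient_moment θstar hmem)
  have hBx4m : ∫ x, ‖Bx x‖ ^ 4 ∂P ≤ H ^ 4 := integral_pow_four_le_of_pow_eight hBx8.norm hBx8m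
  have hεx4m : ∫ x, ‖εx x‖ ^ 4 ∂P ≤ L ^ 4 := by
    refine le_of_eq_of_le ?_ (integral_pow_four_le_of_pow_eight hεx8 hLc8)
    exact integral_congr_ae (.of_forall fun x => Even.pow_abs (by decide) (εx x))
  have hl0 : 0 ≤ l := integral_nonneg hLip0
  have hlL : l ≤ L := by
    have h2 := integral_sq_le_of_pow_eight hLip hL8
    have hj := (convexOn_pow (𝕜 := ℝ) 2).map_integral_le (μ := P) (f := Lip)
      (by fun_prop) isClosed_Ici (.of_forall hLip0) (hLip.integrable (by norm_num))
      (hLip.mono_exponent (by norm_num : (2 : ENNReal) ≤ 8)).integrable_sq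
    exact le_of_pow_le_pow_left₀ two_ne_zero hL (hj.trans h2)
  -- the averages
  let g : (Fin n → X) → Vec d := fun S => (1 / (n : ℝ)) • ∑ j, gx (S j)
  let B : (Fin n → X) → Vec d →L[ℝ] Vec d := fun S => (1 / (n : ℝ)) • ∑ j, Bx (S j)
  let ε : (Fin n → X) → ℝ := fun S => (1 / (n : ℝ)) • ∑ j, εx (S j)
  have hε (S : Fin n → X) : (1 / (n : ℝ)) • ∑ j, Lip (S j) = l + ε S := by
    simp only [ε, εx, smul_eq_mul, Finset.sum_sub_distrib, Finset.sum_const, Finset.card_univ,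
      Fintype.card_fin, nsmul_eq_mul]
    field_simp
    ring
  have hg4 : MemLp g 4 (sampleLaw P n) :=
    memLp_avg hgx4 n
  have hB4 : MemLp B 4 (sampleLaw P n) :=
    memLp_avg hBx4 n
  have hε4 : MemLp ε 4 (sampleLaw P n) :=
    memLp_avg hεx4 n
  have : IsProbabilityMeasure (sampleLaw P n) := by unfold sampleLaw; infer_instance
  have hq : ∫ S, (‖g S‖ + ‖B S‖ + |ε S|) ^ 4 ∂(sampleLaw P n) ≤ A / n ^ 2 := by
    have ig := hg4.integrable_norm_pow (p := 4) (by norm_num)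
    have iB := hB4.integrable_norm_pow (p := 4) (by norm_num)
    have iε := hε4.integrable_norm_pow (p := 4) (by norm_num)
    have igB : Integrable (fun S => ‖g S‖ ^ 4 + ‖B S‖ ^ 4) (sampleLaw P n) := ig.add iB
    calc ∫ S, (‖g S‖ + ‖B S‖ + |ε S|) ^ 4 ∂(sampleLaw P n)
        ≤ ∫ S, 27 * (‖g S‖ ^ 4 + ‖B S‖ ^ 4 + ‖ε S‖ ^ 4) ∂(sampleLaw P n) :=
          integral_mono_of_nonneg (.of_forall fun S => by positivity)
            ((igB.add iε).const_mul 27) (.of_forall fun S => add_add_pow_four_le)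
      _ = 27 * (∫ S, ‖g S‖ ^ 4 ∂(sampleLaw P n) + ∫ S, ‖B S‖ ^ 4 ∂(sampleLaw P n)
            + ∫ S, ‖ε S‖ ^ 4 ∂(sampleLaw P n)) := by
          rw [integral_const_mul, integral_add igB iε, integral_add ig iB]
      _ ≤ 27 * (K₁ * G ^ 4 / n ^ 2 + K₂ * H ^ 4 / n ^ 2 + K₃ * L ^ 4 / n ^ 2) := by
          gcongr
          · exact (hmom₁ X P gx hgx4 hgx0 n hn).trans (by gcongr)
          · exact (hmom₂ X P Bx hBx4 hBx0 n hn).trans (by gcongr)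
          · exact (hmom₃ X P εx hεx4 hεx0 n hn).trans (by gcongr)
      _ = A / n ^ 2 := by rw [hAdef]; ring
  have hg2 : ∫ S, ‖g S‖ ^ 2 ∂(sampleLaw P n) ≤ G ^ 2 / n := by
    have h' : ∫ S : Fin n → X, ‖∑ j, gx (S j)‖ ^ 2 ∂(sampleLaw P n) = n * ∫ x, ‖gx x‖ ^ 2 ∂P := by
      simpa [sampleLaw] using integral_norm_sum_sq (ι := Fin n) hgx2 hgx0
    simp only [g, norm_smul, mul_pow, integral_const_mul, h']
    rw [Real.norm_of_nonneg (by positivity)]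
    calc _ = (∫ x, ‖gx x‖ ^ 2 ∂P) / n := by field_simp
      _ ≤ _ := by gcongr
  have hg0 : ∫ S, g S ∂(sampleLaw P n) = 0 := by
    simp only [g]
    rw [integral_smul, sampleLaw, integral_finsetSum _ fun j _ =>
      (memLp_eval hgx2 j).integrable (by norm_num)]
    have (j : Fin n) : ∫ S : Fin n → X, gx (S j) ∂(Measure.pi fun _ => P) = 0 :=
      (integral_eval hgx2.1 j).trans hgx0
    simp [this]
  -- The prefactor is `1 / n²`, but only `n` diagonal pairs survive, which leaves `1 / n`.
  have hβ : ‖∫ S, J (B S (J (g S))) ∂(sampleLaw P n)‖ ≤ (H * G / lam ^ 2) / n := by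
    let Q : (Vec d →L[ℝ] Vec d) →L[ℝ] Vec d →L[ℝ] Vec d :=
      (ContinuousLinearMap.compL ℝ (Vec d) (Vec d) (Vec d) J).comp
        ((ContinuousLinearMap.compL ℝ (Vec d) (Vec d) (Vec d)).flip J)
    have hQ (M v) : Q M v = J (M (J v)) := rfl
    have hQn (M v) : ‖Q M v‖ ≤ 1 / lam ^ 2 * (‖M‖ * ‖v‖) := by
      calc ‖J (M (J v))‖ ≤ ‖M (J v)‖ / lam := hJ _
        _ ≤ (‖M‖ * (‖v‖ / lam)) / lam := by
            gcongr
            exact (M.le_opNorm _).trans (by gcongr; exact hJ v)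
        _ = _ := by field_simp
    have h := integral_bilin_sum (ι := Fin n) Q hBx2 hgx2 hBx0
    have e (S : Fin n → X) : J (B S (J (g S)))
        = ((1 / (n : ℝ)) * (1 / (n : ℝ))) • Q (∑ j, Bx (S j)) (∑ j, gx (S j)) := by
      rw [hQ]
      simp only [B, g, map_smul, smul_apply, smul_smul]
    have h' : ∫ S, J (B S (J (g S))) ∂(sampleLaw P n) = (1 / (n : ℝ)) • ∫ x, Q (Bx x) (gx x) ∂P := by
      simp only [e]
      rw [integral_smul, sampleLaw, h, smul_smul, Fintype.card_fin]
      congr 1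
      field_simp
    have hb := norm_integral_bilin_le Q hBx2 hgx2 hQn (by positivity) hH hG hBx2m hgx2m
    rw [h', norm_smul, Real.norm_of_nonneg (by positivity)]
    calc _ ≤ 1 / (n : ℝ) * (1 / lam ^ 2 * (H * G)) := by gcongr
      _ = _ := by ring
  have hDm : AEStronglyMeasurable (fun S => T S - θstar) (sampleLaw P n) :=
    (hT.aemeasurable.sub_const θstar).aestronglyMeasurable
  have hDR : ∀ᵐ S ∂(sampleLaw P n), ‖T S - θstar‖ ≤ R := by
    filter_upwards [hT.mem] with S hTS using hΘ.radius.2 ⟨T S, hTS, rfl⟩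
  have hpt : ∀ᵐ S ∂(sampleLaw P n),
      ‖(T S - θstar) + J (g S)‖ ≤ C * (‖g S‖ + ‖B S‖ + |ε S|) ^ 2 ∧
      ‖(T S - θstar) + J (g S) + J (B S (J (g S)))‖
        ≤ L / lam * ‖T S - θstar‖ ^ 2 + C * (‖g S‖ + ‖B S‖ + |ε S|) ^ 3 := by
    filter_upwards [hT.mem, hT.isMinOn, hDR] with S hTS hmin hDS
    refine hdev (T S - θstar) (g S) M₀ (B S) J l (ε S) hl0 hlL hJM hJ hDS fun hgS hBS hεS => ?_
    rw [← hε S]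
    refine norm_empiricalMinimizer_sub_le hR hS hΘ.convex hlam hn hLip0
      (fun x θ hθ => hle x θstar hmem θ hθ) hcoer hTS hmin hδ ?_ ?_ hBS hgS
    · exact (min_le_left _ _).trans_lt (by linarith)
    · rw [hε S]
      have h1 : l + ε S ≤ L + 1 := add_le_add hlL ((le_abs_self _).trans hεS)
      have h2 : δ ≤ lam / (4 * (L + 1)) := min_le_right _ _
      calc (l + ε S) * δ ≤ (L + 1) * (lam / (4 * (L + 1))) := by gcongr
        _ = lam / 4 := by field_simp
  obtain ⟨h1, h2⟩ := moment_bounds_of_deviation_bounds (D := fun S => T S - θstar) (G := G)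
    (L := L) (R := R) hn hlam hL hC hA hJ hDm hDR hg4 hB4 hε4 (hpt.mono fun S h => h.1)
    (hpt.mono fun S h => h.2) hq hg2 hg0 hβ
  refine ⟨MemLp.of_bound hDm R hDR, h1.trans ?_, h2.trans ?_⟩
  · gcongr
    exact le_add_of_nonneg_right (by positivity)
  · refine add_le_add le_rfl (div_le_div_of_nonneg_right ?_ (by positivity))
    have h3 : 0 ≤ 2 * C ^ 2 * A := by positivity
    linarith

end AvgM

/-! ### Assembly of the risk bound -/

theorem corollary1 :
    ∃ c : ℝ, 0 < c ∧
      ∀ (d : ℕ), 2 ≤ d →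
      ∀ (R lam ρ G H L : ℝ),
      ∃ C₁ C₂ : ℝ, 0 ≤ C₁ ∧ 0 ≤ C₂ ∧
        ∀ (X : Type*) [MeasurableSpace X] (P : Measure X) [IsProbabilityMeasure P]
          (f : AvgM.Vec d → X → ℝ) (Θ : Set (AvgM.Vec d)) (θstar : AvgM.Vec d),
          AvgM.RiskProblem f P Θ θstar →
          AvgM.ParameterAssumption Θ θstar R →
          AvgM.LocalStrongConvexity f P Θ θstar lam →
          AvgM.SmoothnessAssumption f P Θ θstar ρ G H L →
          ∀ (m n : ℕ), 1 ≤ m → 1 ≤ n →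
          ∀ T : Fin m → (Fin n → X) → AvgM.Vec d,
            (∀ i, AvgM.IsEmpiricalMinimizer f P Θ (T i)) →
            Integrable (fun S => ‖AvgM.average T S - θstar‖ ^ 2) (AvgM.dataLaw P m n) ∧
            ∫ S, ‖AvgM.average T S - θstar‖ ^ 2 ∂(AvgM.dataLaw P m n) ≤
              2 * G ^ 2 / (lam ^ 2 * n * m)
              + c * G ^ 2 / (lam ^ 4 * n ^ 2)
                  * (H ^ 2 * Real.log d + L ^ 2 * G ^ 2 / lam ^ 2)
              + C₁ / (m * n ^ 2) + C₂ / n ^ 3 := by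
  refine ⟨16, by norm_num, fun d hd R lam ρ G H L => ?_⟩
  by_cases hpos : 0 ≤ R ∧ 0 < lam ∧ 0 < ρ ∧ 0 ≤ G ∧ 0 ≤ H ∧ 0 ≤ L
  swap
  · refine ⟨0, 0, le_rfl, le_rfl, fun X _ P _ f Θ θstar hR hΘ hlsc hS => absurd ?_ hpos⟩
    obtain ⟨θ, -, hθ⟩ := hΘ.radius.1
    exact ⟨hθ ▸ norm_nonneg _, hlsc.lam_pos, hS.rho_pos, hS.G_nonneg, hS.H_nonneg, hS.L_nonneg⟩
  obtain ⟨hR0, hlam, hρ, hG, hH, hL⟩ := hpos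
  obtain ⟨C, hC, hmain⟩ := AvgM.exists_empiricalMinimizer_moment_bounds (d := d) (by omega)
    hR0 hlam hρ hG hH hL
  -- `C` is the second-order part of the mean square, later divided by `m`; `2 * C ^ 2` comes from
  -- squaring the bias remainder `C / (n * √n)`.
  refine ⟨C, 2 * C ^ 2, hC, by positivity, ?_⟩
  intro X _ P _ f Θ θstar hR hΘ hlsc hS m n hm hn T hT
  have hm0 : (0 : ℝ) < m := by exact_mod_cast hm
  have hn0 : (0 : ℝ) < n := by exact_mod_cast hn
  have hi (i : Fin m) := hmain X P f Θ θstar hR hΘ hlsc hS n hn (T i) (hT i)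
  have : IsProbabilityMeasure (AvgM.sampleLaw P n) := by unfold AvgM.sampleLaw; infer_instance
  set s := H * G / lam ^ 2 + 2 * L * G ^ 2 / lam ^ 3 with hs
  have hsq : ∀ i, ‖∫ S, (T i S - θstar) ∂(AvgM.sampleLaw P n)‖ ^ 2
      ≤ 2 * s ^ 2 / n ^ 2 + 2 * C ^ 2 / n ^ 3 := by
    intro i
    calc _ ≤ (s / n + C / (n * Real.sqrt n)) ^ 2 := by gcongr; exact (hi i).2.2
      _ ≤ 2 * ((s / n) ^ 2 + (C / (n * Real.sqrt n)) ^ 2) := add_sq_le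
      _ = _ := by
        rw [div_pow, div_pow, mul_pow, Real.sq_sqrt hn0.le]
        ring
  obtain ⟨hmemLp, hle⟩ := AvgM.integral_norm_avg_sq_le (ν := AvgM.sampleLaw P n) hm
    (Z := fun i S => T i S - θstar) (fun i => (hi i).1)
    (b := 2 * s ^ 2 / n ^ 2 + 2 * C ^ 2 / n ^ 3) (by positivity) (fun i => (hi i).2.1) hsq
  have havg (S : Fin m → Fin n → X) : AvgM.average T S - θstar
      = (1 / (m : ℝ)) • ∑ i, (T i (S i) - θstar) := by
    simp only [AvgM.average, Finset.sum_sub_distrib, smul_sub, Finset.sum_const, Finset.card_univ,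
      Fintype.card_fin]
    rw [← Nat.cast_smul_eq_nsmul ℝ, smul_smul, one_div_mul_cancel hm0.ne', one_smul]
  simp only [havg]
  refine ⟨hmemLp.integrable_norm_pow (p := 2) two_ne_zero, hle.trans ?_⟩
  have hlog : (1 / 2 : ℝ) ≤ Real.log d := by
    have h2 : (2 : ℝ) ≤ d := by exact_mod_cast hd
    have := Real.log_le_log two_pos h2
    linarith [Real.log_two_gt_d9]
  -- The Lipschitz part of the bias fixes the constant: `2 * 2 * 2 ^ 2 = 16`. The Hessian part then
  -- needs only `1/4 ≤ log d`.
  have hs2 : 2 * s ^ 2 ≤ 16 * G ^ 2 / lam ^ 4 * (H ^ 2 * Real.log d + L ^ 2 * G ^ 2 / lam ^ 2) := by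
    calc 2 * s ^ 2 ≤ 2 * (2 * ((H * G / lam ^ 2) ^ 2 + (2 * L * G ^ 2 / lam ^ 3) ^ 2)) := by
          gcongr; exact add_sq_le
      _ = 16 * G ^ 2 / lam ^ 4 * (H ^ 2 * (1 / 4) + L ^ 2 * G ^ 2 / lam ^ 2) := by
          field_simp; ring
      _ ≤ _ := by gcongr; linarith
  have hs3 : 2 * s ^ 2 / (n : ℝ) ^ 2 ≤ 16 * G ^ 2 / (lam ^ 4 * n ^ 2)
      * (H ^ 2 * Real.log d + L ^ 2 * G ^ 2 / lam ^ 2) := by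
    calc _ ≤ _ := div_le_div_of_nonneg_right hs2 (by positivity)
      _ = _ := by field_simp
  have e : (2 * G ^ 2 / (lam ^ 2 * n) + C / (n : ℝ) ^ 2) / m
      = 2 * G ^ 2 / (lam ^ 2 * n * m) + C / (m * n ^ 2) := by field_simp
  rw [e]
  linarith
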